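/- Let $\Omega\subset\mathbb{R}^2=\mathbb{C}$ be a bounded simply connected domain (for instance one with Lipschitz boundary; no regularity of the boundary is needed for the weak formulation below), and let $D=\mathbb{C}\setminus\overline{\Omega}$. Let $z=\Phi(\zeta)$ be a conformal map of $\{|\zeta|>1\}$ onto $D$ of the form $$\Phi(\zeta)=c\,\zeta+\mu_0+\frac{\mu_1}{\zeta}+\frac{\mu_2}{\zeta^2}+\cdots,\qquad |\zeta|>1,\quad c>0 .$$ Suppose that the inclusion $\Omega$ is insulating (conductivity $k=0$). For $n\ge 1$ put $P_n^c=r^n\cos n\theta$, $P_n^s=r^n\sin n\theta$, and for $\beta\in\{c,s\}$ let $u=u_n^\beta$ be the solution of $$\Delta u=0\ \text{ in } D,\qquad \frac{\partial u}{\partial\nu}=0\ \text{ on }\partial\Omega,\qquad u(x)-P_n^\beta(x)=O(|x|^{-1})\ \text{ as }|x|\to\infty ,$$ where the Neumann condition is understood weakly: $u\in H^1(D\cap B)$ for every disc $B$, and $\int_D\nabla u\cdot\nabla\varphi=0$ for every $C^1$ function $\varphi\in H^1(D)$ that vanishes outside a bounded set. The contracted generalized polarization tensors $M_{mn}^{\alpha\beta}$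 ($\alpha,\beta\in\{c,s\}$, $m,n\ge1$) of $\Omega$ are the real coefficients in the expansion $$u_n^\beta-P_n^\beta=-\sum_{m=1}^\infty\frac{\cos m\theta}{2\pi m r^m}M_{mn}^{c\beta}-\sum_{m=1}^\infty\frac{\sin m\theta}{2\pi m r^m}M_{mn}^{s\beta}\qquad\text{for large } r .$$ Define $$\gamma_{mn}^1=\frac{1}{4\pi m}\bigl(M_{mn}^{cc}-M_{mn}^{ss}+i(M_{mn}^{cs}+M_{mn}^{sc})\bigr),\qquad \gamma_{mn}^2=\frac{1}{4\pi m}\bigl(M_{mn}^{cc}+M_{mn}^{ss}-i(M_{mn}^{cs}-M_{mn}^{sc})\bigr).$$ Then $$c^2=-\gamma_{11}^2\qquad\text{and}\qquad \mu_0=-c^{-2}\gamma_{21}^2 .$$ -/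

import Mathlib

open MeasureTheory Filter Bornology

namespace InsulatedInclusion

/-- The open exterior `ℂ \ closure Ω` of a set `Ω` in the plane `ℝ² = ℂ`. -/
def exterior (Ω : Set ℂ) : Set ℂ := (closure Ω)ᶜ

/-- Test functions on an open set `D`: the `C¹` functions of the Sobolev space `H¹(D)` that vanish
outside a bounded set. They need not vanish on the boundary of `D`; they are dense in the functions
of `H¹(D)` with bounded support. -/
structure IsTestFunction (D : Set ℂ) (φ : ℂ → ℝ) : Prop where
  contDiffOn : ContDiffOn ℝ 1 φ D
  bounded_support : ∃ R : ℝ, ∀ z ∈ D, R < ‖z‖ → φ z = 0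
  sq_integrable : IntegrableOn (fun z => φ z ^ 2) D
  gradient_sq_integrable : IntegrableOn (fun z => ‖gradient φ z‖ ^ 2) D

/-- `u` solves the problem with an insulating inclusion `Ω` and background potential `h`:
`Δu = 0` in `ℂ \ closure Ω`, `∂u/∂ν = 0` on `∂Ω`, and `u - h = O(|z|⁻¹)` at infinity.
The Neumann condition is the usual weak one: `u` is in `H¹(D ∩ B)` for the exterior `D` and every
disc `B`, and `∫_D ∇u · ∇φ = 0` for all test functions `φ`.
The values of `u` on `closure Ω` are irrelevant. -/
structure IsSolution (Ω : Set ℂ) (h u : ℂ → ℝ) : Prop where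
  harmonic : InnerProductSpace.HarmonicOnNhd u (exterior Ω)
  sq_integrable : ∀ R : ℝ, IntegrableOn (fun z => u z ^ 2) (exterior Ω ∩ Metric.ball 0 R)
  gradient_sq_integrable :
    ∀ R : ℝ, IntegrableOn (fun z => ‖gradient u z‖ ^ 2) (exterior Ω ∩ Metric.ball 0 R)
  neumann : ∀ φ : ℂ → ℝ, IsTestFunction (exterior Ω) φ →
    ∫ z in exterior Ω, inner ℝ (gradient u z) (gradient φ z) = 0
  decay : (fun z => u z - h z) =O[cobounded ℂ] fun z => ‖z‖⁻¹

/-- The two superscripts `c` and `s` (cosine and sine). -/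
inductive Trig
  | c
  | s

/-- `cos t` for the superscript `c`, `sin t` for the superscript `s`. -/
noncomputable def Trig.eval : Trig → ℝ → ℝ
  | .c, t => Real.cos t
  | .s, t => Real.sin t

/-- The homogeneous harmonic polynomials `P_n^c = Re zⁿ = rⁿ cos nθ`, `P_n^s = Im zⁿ = rⁿ sin nθ`. -/
noncomputable def harmonicPoly : Trig → ℕ+ → ℂ → ℝ
  | .c, n, z => (z ^ (n : ℕ)).re
  | .s, n, z => (z ^ (n : ℕ)).im

theorem harmonicPoly_polar (β : Trig) (n : ℕ+) (r θ : ℝ) :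
    harmonicPoly β n (r * Complex.exp (θ * Complex.I)) = r ^ (n : ℕ) * β.eval (n * θ) := by
  have h : ((r : ℂ) * Complex.exp (θ * Complex.I)) ^ (n : ℕ)
      = ((r ^ (n : ℕ) : ℝ) : ℂ) * Complex.exp (((n * θ : ℝ) : ℂ) * Complex.I) := by
    rw [mul_pow, ← Complex.exp_nat_mul]
    push_cast
    ring_nf
  cases β
  · simp only [harmonicPoly, Trig.eval, h, Complex.re_ofReal_mul, Complex.exp_ofReal_mul_I_re]
  · simp only [harmonicPoly, Trig.eval, h, Complex.im_ofReal_mul, Complex.exp_ofReal_mul_I_im]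

/-- The multipole expansion near infinity (absolutely convergent for large `r`)
`f(r e^{iθ}) = - ∑_{m ≥ 1} (cos mθ / (2πm r^m)) A^c_m - ∑_{m ≥ 1} (sin mθ / (2πm r^m)) A^s_m`. -/
def HasMultipoleExpansion (f : ℂ → ℝ) (A : Trig → ℕ+ → ℝ) : Prop :=
  ∃ R > 0, ∀ r : ℝ, R < r →
    (∀ α, Summable fun m : ℕ+ => A α m / (2 * Real.pi * m * r ^ (m : ℕ))) ∧
    ∀ θ : ℝ, HasSum
      (fun m : ℕ+ => - (Real.cos (m * θ) / (2 * Real.pi * m * r ^ (m : ℕ)) * A .c m)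
        - Real.sin (m * θ) / (2 * Real.pi * m * r ^ (m : ℕ)) * A .s m)
      (f (r * Complex.exp (θ * Complex.I)))

/-- `A` is the system of multipole coefficients of `u - P_n^β`, where `u` solves the problem with
insulating inclusion `Ω` and background potential `P_n^β`. -/
def IsResponse (Ω : Set ℂ) (β : Trig) (n : ℕ+) (A : Trig → ℕ+ → ℝ) : Prop :=
  ∃ u : ℂ → ℝ, IsSolution Ω (harmonicPoly β n) u ∧
    HasMultipoleExpansion (fun z => u z - harmonicPoly β n z) A

open Classical in
/-- The contracted generalized polarization tensor `M^{αβ}_{mn}` of an insulating inclusion `Ω`: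
the coefficient of type `α` and order `m` in the multipole expansion of the response to the
background potential `P_n^β` (`0` if there is no response with such an expansion). -/
noncomputable def contractedGPT (Ω : Set ℂ) (α β : Trig) (m n : ℕ+) : ℝ :=
  if hA : ∃ A, IsResponse Ω β n A then hA.choose α m else 0

/-- `γ¹_{mn} = (M^{cc}_{mn} - M^{ss}_{mn} + i (M^{cs}_{mn} + M^{sc}_{mn})) / (4πm)`. -/
noncomputable def gamma1 (Ω : Set ℂ) (m n : ℕ+) : ℂ :=
  1 / (4 * Real.pi * m) *
    (contractedGPT Ω .c .c m n - contractedGPT Ω .s .s m n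
      + Complex.I * (contractedGPT Ω .c .s m n + contractedGPT Ω .s .c m n))

/-- `γ²_{mn} = (M^{cc}_{mn} + M^{ss}_{mn} - i (M^{cs}_{mn} - M^{sc}_{mn})) / (4πm)`. -/
noncomputable def gamma2 (Ω : Set ℂ) (m n : ℕ+) : ℂ :=
  1 / (4 * Real.pi * m) *
    (contractedGPT Ω .c .c m n + contractedGPT Ω .s .s m n
      - Complex.I * (contractedGPT Ω .c .s m n - contractedGPT Ω .s .c m n))

/-- `Φ` is the conformal map of `|ζ| > 1` onto the exterior of `Ω` with the expansion
`Φ(ζ) = c ζ + μ₀ + μ₁/ζ + μ₂/ζ² + ⋯`, normalized by `c > 0`. -/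
structure IsExteriorMap (Ω : Set ℂ) (Φ : ℂ → ℂ) (c : ℝ) (μ : ℕ → ℂ) : Prop where
  holomorphic : DifferentiableOn ℂ Φ {ζ | 1 < ‖ζ‖}
  bijOn : Set.BijOn Φ {ζ | 1 < ‖ζ‖} (exterior Ω)
  expansion : ∀ ζ : ℂ, 1 < ‖ζ‖ → HasSum (fun k : ℕ => μ k / ζ ^ k) (Φ ζ - c * ζ)
  pos : 0 < c

end InsulatedInclusion

/-!
Write `D` for the exterior of `Ω`, `Ψ : D → {|ζ| > 1}` for the inverse of `Φ`, and let `e = 1` or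
`e = -i`, so that `Re (e z)` is the background potential `Re z` or `Im z`. With `ζ = Ψ(z)`, the
complex potential `W = e (c ζ + μ₀) + conj e · c / ζ` has imaginary part
`Im (e μ₀) + c (1 - |ζ|⁻²) Im (e ζ)`, which is constant on the unit circle. Hence `u = Re W` is the
solution, and since `z = c ζ + μ₀ + ∑_{k ≥ 1} μₖ ζ⁻ᵏ`,
`W - e z = conj e · c / ζ - e ∑_{k ≥ 1} μₖ ζ⁻ᵏ`.
The combination of the two responses in `γ²ₘ₁` cancels the `μₖ`, and `γ²ₘ₁` is the coefficient of
`z⁻ᵐ` in `-c / Ψ(z)` (`IsExteriorMap.gamma2_one_eq`). Solving `z = c ζ + μ₀ + O(1/ζ)` for `1/ζ` gives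
`1/Ψ(z) = c / z + c μ₀ / z² + ⋯` (`coeff_inverse_at_infinity`), which is the claim.

No regularity of the boundary is available, so the two analytic facts about the weak problem are
obtained as follows.

* Existence. The gradient of `u` is square integrable up to the boundary by conformal invariance.
  For the Neumann condition let `s = Im W - Im (e μ₀)`. The field `∇u` is a rotation of `∇s`, so
  `τ(s) ∇u` is divergence free for every function `τ`. If `τ` vanishes near `0`, then `τ(s) φ` has
  compact support in `D` for a test function `φ`, and `∫ τ(s) ∇u · ∇φ = 0`. Letting `τ` increase to
  the indicator of `{t ≠ 0}` gives the condition (`setIntegral_inner_gradient_re_eq_zero`).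
* Uniqueness. The difference `w` of two solutions is `O(1/|z|)`. Testing with `η² w`, where `η` is a
  cutoff at scale `R`, gives `∫ η² |∇w|² ≤ 4 ∫ w² |∇η|² = O(R⁻²)`, so `w` is constant on the
  connected set `D`, hence `0` (`IsSolution.eqOn_zero`). The multipole coefficients are determined by
  the solution (`HasMultipoleExpansion.unique`), so the contracted GPTs can be read off from `W`.
-/

open scoped Topology ComplexConjugate

namespace InsulatedInclusion

/-! ### Holomorphic inverses and power series -/

/-- By the open mapping theorem, a local left inverse of a holomorphic function is continuous, and
it is also a local right inverse. -/
theorem continuousAt_of_eventually_leftInverse {f g : ℂ → ℂ} {z₀ : ℂ} (hf : AnalyticAt ℂ f z₀)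
    (hg : ∀ᶠ z in 𝓝 z₀, g (f z) = z) :
    ContinuousAt g (f z₀) ∧ ∀ᶠ w in 𝓝 (f z₀), f (g w) = w := by
  have hne : ¬ ∀ᶠ z in 𝓝 z₀, f z = f z₀ := by
    intro h
    have h1 : ∀ᶠ z in 𝓝[≠] z₀, z = z₀ := by
      filter_upwards [nhdsWithin_le_nhds h, nhdsWithin_le_nhds hg] with z h1 h2
      rw [← h2, h1, hg.self_of_nhds]
    have h2 : ∀ᶠ z in 𝓝[≠] z₀, z ≠ z₀ := eventually_mem_nhdsWithin
    obtain ⟨z, h3, h4⟩ := (h1.and h2).exists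
    exact h4 h3
  have hopen : 𝓝 (f z₀) ≤ map f (𝓝 z₀) :=
    hf.eventually_constant_or_nhds_le_map_nhds.resolve_left hne
  refine ⟨?_, hopen ?_⟩
  · rw [ContinuousAt, hg.self_of_nhds]
    refine Tendsto.mono_left ?_ hopen
    rw [tendsto_map'_iff]
    exact Tendsto.congr' (hg.mono fun z hz => hz.symm) tendsto_id
  · rw [mem_map]
    filter_upwards [hg] with z hz
    change f (g (f z)) = f z
    rw [hz]

/-- A local left inverse of a holomorphic function is holomorphic. No hypothesis on the derivative
is needed: the left inverse is continuous by the open mapping theorem and differentiable off the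
isolated critical values, which are removable singularities. -/
theorem analyticAt_of_eventually_leftInverse {f g : ℂ → ℂ} {z₀ : ℂ} (hf : AnalyticAt ℂ f z₀)
    (hg : ∀ᶠ z in 𝓝 z₀, g (f z) = z) : AnalyticAt ℂ g (f z₀) := by
  obtain ⟨hcont, hright⟩ := continuousAt_of_eventually_leftInverse hf hg
  have hgz : g (f z₀) = z₀ := hg.self_of_nhds
  refine Complex.analyticAt_of_differentiable_on_punctured_nhds_of_continuousAt ?_ hcont
  have hderiv : ∀ᶠ z in 𝓝[≠] z₀, deriv f z ≠ 0 := by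
    refine hf.deriv.eventually_eq_zero_or_eventually_ne_zero.resolve_left fun h => ?_
    obtain ⟨ε, hε, hball⟩ := Metric.eventually_nhds_iff_ball.1
      ((h.and hf.eventually_analyticAt).and hg)
    have hconst : ∀ z ∈ Metric.ball z₀ ε, z = z₀ := fun z hz => by
      rw [← (hball z hz).2, Metric.isOpen_ball.is_const_of_deriv_eq_zero
        (convex_ball z₀ ε).isPreconnected
        (fun y hy => (hball y hy).1.2.differentiableAt.differentiableWithinAt)
        (fun y hy => (hball y hy).1.1) hz (Metric.mem_ball_self hε), hgz]
    have h1 : ∀ᶠ z in 𝓝[≠] z₀, z = z₀ :=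
      nhdsWithin_le_nhds (by filter_upwards [Metric.ball_mem_nhds z₀ hε] using hconst)
    have h2 : ∀ᶠ z in 𝓝[≠] z₀, z ≠ z₀ := eventually_mem_nhdsWithin
    obtain ⟨z, h3, h4⟩ := (h1.and h2).exists
    exact h4 h3
  have hpunct : Tendsto g (𝓝[≠] (f z₀)) (𝓝[≠] z₀) := by
    rw [ContinuousAt, hgz] at hcont
    refine tendsto_nhdsWithin_iff.2 ⟨hcont.mono_left nhdsWithin_le_nhds, ?_⟩
    filter_upwards [nhdsWithin_le_nhds hright, self_mem_nhdsWithin] with w hw hw' hgw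
    exact hw' (by rw [Set.mem_singleton_iff, ← hw, hgw])
  have han : ∀ᶠ z in 𝓝[≠] z₀, AnalyticAt ℂ f z := nhdsWithin_le_nhds hf.eventually_analyticAt
  have hev : ∀ᶠ z in 𝓝[≠] z₀, ∀ᶠ y in 𝓝 z, g (f y) = y :=
    nhdsWithin_le_nhds hg.eventually_nhds
  filter_upwards [hpunct.eventually han, hpunct.eventually hderiv, hpunct.eventually hev,
    nhdsWithin_le_nhds hright.eventually_nhds] with w hfw hdw hgw hr
  have hc := (continuousAt_of_eventually_leftInverse hfw hgw).1
  rw [hr.self_of_nhds] at hc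
  exact (HasDerivAt.of_local_left_inverse hc hfw.differentiableAt.hasDerivAt hdw
    hr).differentiableAt

theorem hasFPowerSeriesAt_ofScalars {a : ℕ → ℂ} {f : ℂ → ℂ}
    (h : ∀ᶠ w in 𝓝 (0 : ℂ), HasSum (fun k => a k * w ^ k) (f w)) :
    HasFPowerSeriesAt f (FormalMultilinearSeries.ofScalars ℂ a) 0 := by
  rw [hasFPowerSeriesAt_iff]
  filter_upwards [h] with w hw
  simpa [mul_comm] using hw

/-! ### Multipole expansions -/

theorem eventually_cobounded_norm_gt (R : ℝ) : ∀ᶠ z in cobounded ℂ, R < ‖z‖ :=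
  (tendsto_norm_cobounded_atTop (E := ℂ)).eventually_gt_atTop R

theorem eventually_cobounded_iff {p : ℂ → Prop} :
    (∀ᶠ z in cobounded ℂ, p z) ↔ ∃ R : ℝ, 0 < R ∧ ∀ z, R < ‖z‖ → p z := by
  constructor
  · intro h
    obtain ⟨R, -, hR⟩ := (Metric.hasBasis_cobounded_compl_closedBall (0 : ℂ)).eventually_iff.1 h
    refine ⟨max R 1, by positivity, fun z hz => hR ?_⟩
    simpa using lt_of_le_of_lt (le_max_left R 1) hz
  · rintro ⟨R, -, h⟩
    exact (eventually_cobounded_norm_gt R).mono h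

theorem eventually_inv_cobounded {p : ℂ → Prop} (h : ∀ᶠ w in 𝓝 (0 : ℂ), p w) :
    ∀ᶠ z in cobounded ℂ, p z⁻¹ :=
  tendsto_inv₀_cobounded.eventually h

theorem re_mul_inv_polar (a : ℂ) (m : ℕ) (r θ : ℝ) :
    (a * ((r * Complex.exp (θ * Complex.I))⁻¹) ^ m).re
      = (Real.cos (m * θ) * a.re + Real.sin (m * θ) * a.im) / r ^ m := by
  have h : ((r : ℂ) * Complex.exp (θ * Complex.I))⁻¹ ^ m
      = (((r ^ m)⁻¹ : ℝ) : ℂ) * Complex.exp (((-(m * θ) : ℝ) : ℂ) * Complex.I) := by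
    rw [mul_inv, mul_pow, ← Complex.exp_neg, ← Complex.exp_nat_mul]
    push_cast
    rw [inv_pow]
    ring_nf
  rw [h, mul_left_comm, Complex.re_ofReal_mul, Complex.mul_re, Complex.exp_ofReal_mul_I_re,
    Complex.exp_ofReal_mul_I_im, Real.cos_neg, Real.sin_neg]
  field_simp
  ring

/-- The real multipole coefficients of the real part of the Laurent series `∑ aₘ z⁻ᵐ`. -/
noncomputable def multipoleCoeff (a : ℕ → ℂ) : Trig → ℕ+ → ℝ
  | .c, m => -(2 * Real.pi * m * (a m).re)
  | .s, m => -(2 * Real.pi * m * (a m).im)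

/-- The real part of a function holomorphic at infinity and vanishing there has a multipole
expansion. -/
theorem hasMultipoleExpansion_re {H : ℂ → ℂ} {p : FormalMultilinearSeries ℂ ℂ ℂ}
    (hH : HasFPowerSeriesAt H p 0) (h0 : H 0 = 0) {f : ℂ → ℝ}
    (hf : ∀ᶠ z in cobounded ℂ, f z = (H z⁻¹).re) :
    HasMultipoleExpansion f (multipoleCoeff p.coeff) := by
  have hp0 : p.coeff 0 = 0 := by
    have := hH.coeff_zero (fun _ => 1)
    rw [h0] at this
    exact this
  rw [hasFPowerSeriesAt_iff] at hH
  obtain ⟨R, hR, hev⟩ := eventually_cobounded_iff.1 (hf.and (eventually_inv_cobounded hH))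
  refine ⟨R, hR, fun r hr => ?_⟩
  have hr0 : 0 < r := hR.trans hr
  have hsum : ∀ θ : ℝ, HasSum (fun m : ℕ+ => p.coeff m *
      ((r * Complex.exp (θ * Complex.I))⁻¹) ^ (m : ℕ)) (H (r * Complex.exp (θ * Complex.I))⁻¹) := by
    intro θ
    have h1 := (hev (r * Complex.exp (θ * Complex.I)) (by
      rw [norm_mul, Complex.norm_exp_ofReal_mul_I]; simpa [abs_of_pos hr0] using hr)).2
    rw [zero_add] at h1
    refine (Function.Injective.hasSum_iff PNat.coe_injective (f := fun m : ℕ => p.coeff m *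
      ((r * Complex.exp (θ * Complex.I))⁻¹) ^ m) ?_).2 ?_
    · intro m hm
      have : m = 0 := by
        by_contra h
        exact hm ⟨⟨m, Nat.pos_of_ne_zero h⟩, rfl⟩
      simp [this, hp0]
    · simpa [mul_comm] using h1
  have hsummable : Summable fun m : ℕ+ => ‖p.coeff m‖ / r ^ (m : ℕ) := by
    refine ((hsum 0).summable.norm).congr fun m => ?_
    simp [abs_of_pos hr0, div_eq_mul_inv]
  have hpi := Real.pi_pos
  constructor
  · have hle : ∀ α, ∀ m : ℕ+, ‖multipoleCoeff p.coeff α m / (2 * Real.pi * m * r ^ (m : ℕ))‖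
        ≤ ‖p.coeff m‖ / r ^ (m : ℕ) := by
      intro α m
      have hm : (0 : ℝ) < m := by exact_mod_cast m.pos
      have key : ∀ x : ℝ, ‖-(2 * Real.pi * m * x) / (2 * Real.pi * m * r ^ (m : ℕ))‖
          = |x| / r ^ (m : ℕ) := by
        intro x
        rw [neg_div, norm_neg, mul_div_mul_left _ _ (by positivity), norm_div, norm_pow,
          Real.norm_eq_abs, Real.norm_eq_abs, abs_of_pos hr0]
      cases α
      · rw [multipoleCoeff, key]
        gcongr
        exact Complex.abs_re_le_norm _
      · rw [multipoleCoeff, key]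
        gcongr
        exact Complex.abs_im_le_norm _
    exact fun α => Summable.of_norm_bounded hsummable (hle α)
  · intro θ
    have h1 := Complex.hasSum_re (hsum θ)
    rw [← (hev (r * Complex.exp (θ * Complex.I)) (by
      rw [norm_mul, Complex.norm_exp_ofReal_mul_I]; simpa [abs_of_pos hr0] using hr)).1] at h1
    convert h1 using 2 with m
    have hm : (0 : ℝ) < m := by exact_mod_cast m.pos
    rw [re_mul_inv_polar]
    simp only [multipoleCoeff]
    field_simp
    ring

/-- The Laurent coefficients `aₘ`, `m ≥ 1`, with `f = Re ∑ aₘ z⁻ᵐ` for a function `f` with multipole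
coefficients `A`; `a₀ = 0`. -/
noncomputable def laurentCoeff (A : Trig → ℕ+ → ℝ) (k : ℕ) : ℂ :=
  if h : 0 < k then
    ((-(A .c ⟨k, h⟩ / (2 * Real.pi * k)) : ℝ) : ℂ) +
      ((-(A .s ⟨k, h⟩ / (2 * Real.pi * k)) : ℝ) : ℂ) * Complex.I
  else 0

theorem laurentCoeff_pnat (A : Trig → ℕ+ → ℝ) (m : ℕ+) :
    laurentCoeff A m = ((-(A .c m / (2 * Real.pi * m)) : ℝ) : ℂ) +
      ((-(A .s m / (2 * Real.pi * m)) : ℝ) : ℂ) * Complex.I := by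
  rw [laurentCoeff, dif_pos m.pos]
  rfl

theorem laurentCoeff_pnat_re (A : Trig → ℕ+ → ℝ) (m : ℕ+) :
    (laurentCoeff A m).re = -(A .c m / (2 * Real.pi * m)) := by
  simp only [laurentCoeff_pnat, Complex.add_re, Complex.re_ofReal_mul, Complex.ofReal_re,
    Complex.I_re, mul_zero, add_zero]

theorem laurentCoeff_pnat_im (A : Trig → ℕ+ → ℝ) (m : ℕ+) :
    (laurentCoeff A m).im = -(A .s m / (2 * Real.pi * m)) := by
  simp only [laurentCoeff_pnat, Complex.add_im, Complex.im_ofReal_mul, Complex.ofReal_im,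
    Complex.I_im, mul_one, zero_add]

theorem multipoleCoeff_laurentCoeff (A : Trig → ℕ+ → ℝ) :
    multipoleCoeff (laurentCoeff A) = A := by
  have hpi := Real.pi_pos
  funext α m
  have hm : (0 : ℝ) < m := by exact_mod_cast m.pos
  cases α
  · rw [multipoleCoeff, laurentCoeff_pnat_re]
    field_simp
  · rw [multipoleCoeff, laurentCoeff_pnat_im]
    field_simp

/-- A function with a multipole expansion is, near infinity, the real part of a holomorphic
function vanishing at infinity. -/
theorem HasMultipoleExpansion.exists_hasFPowerSeriesAt {f : ℂ → ℝ} {A : Trig → ℕ+ → ℝ}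
    (hA : HasMultipoleExpansion f A) :
    ∃ H : ℂ → ℂ, H 0 = 0 ∧
      HasFPowerSeriesAt H (FormalMultilinearSeries.ofScalars ℂ (laurentCoeff A)) 0 ∧
      ∀ᶠ z in cobounded ℂ, f z = (H z⁻¹).re := by
  obtain ⟨R, hR, hA⟩ := hA
  have hpi := Real.pi_pos
  have h0 : laurentCoeff A 0 = 0 := by simp [laurentCoeff]
  have hinj : ∀ w : ℂ, ∀ x ∉ Set.range ((↑) : ℕ+ → ℕ), laurentCoeff A x * w ^ x = 0 := by
    intro w x hx
    have : x = 0 := by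
      by_contra h
      exact hx ⟨⟨x, Nat.pos_of_ne_zero h⟩, rfl⟩
    simp [this, h0]
  have hsum : ∀ z : ℂ, R < ‖z‖ → Summable fun k : ℕ => laurentCoeff A k * z⁻¹ ^ k := by
    intro z hz
    have hz0 : 0 < ‖z‖ := hR.trans hz
    rw [← Function.Injective.summable_iff PNat.coe_injective (hinj _)]
    refine Summable.of_norm_bounded (((hA _ hz).1 .c).norm.add ((hA _ hz).1 .s).norm) fun m => ?_
    have hm : (0 : ℝ) < m := by exact_mod_cast m.pos
    simp only [Function.comp]
    rw [laurentCoeff_pnat, norm_mul, norm_pow, norm_inv]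
    refine (mul_le_mul_of_nonneg_right (norm_add_le _ _) (by positivity)).trans (le_of_eq ?_)
    simp [abs_of_pos hpi]
    field_simp
  refine ⟨fun w => ∑' k, laurentCoeff A k * w ^ k, ?_, hasFPowerSeriesAt_ofScalars ?_, ?_⟩
  · change ∑' k, laurentCoeff A k * 0 ^ k = 0
    rw [tsum_eq_single 0 (by intro k hk; simp [hk])]
    simp [h0]
  · filter_upwards [Metric.ball_mem_nhds (0 : ℂ) (inv_pos.2 hR)] with w hw
    refine Summable.hasSum ?_
    by_cases hw0 : w = 0
    · refine summable_of_ne_finset_zero (s := {0}) fun k hk => ?_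
      simp only [Finset.mem_singleton] at hk
      simp [hw0, hk]
    · have := hsum w⁻¹ (by
        rw [norm_inv]
        rw [mem_ball_zero_iff] at hw
        exact (lt_inv_comm₀ (norm_pos_iff.2 hw0) hR).1 hw)
      simpa using this
  · filter_upwards [eventually_cobounded_norm_gt R] with z hz
    have h1 := Complex.hasSum_re (hsum z hz).hasSum
    rw [← Function.Injective.hasSum_iff PNat.coe_injective
      (fun x hx => by rw [hinj _ x hx, Complex.zero_re])] at h1
    have h2 := (hA _ hz).2 z.arg
    rw [Complex.norm_mul_exp_arg_mul_I] at h2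
    refine h2.unique ?_
    convert h1 using 2 with m
    have hm : (0 : ℝ) < m := by exact_mod_cast m.pos
    have hz0 : 0 < ‖z‖ := hR.trans hz
    simp only [Function.comp]
    conv_rhs => rw [← Complex.norm_mul_exp_arg_mul_I z, re_mul_inv_polar]
    rw [laurentCoeff_pnat_re, laurentCoeff_pnat_im]
    field_simp
    ring

/-- Multipole coefficients are determined by the function near infinity: the difference of two
systems of coefficients is the power series of a function with vanishing real part. -/
theorem HasMultipoleExpansion.unique {f g : ℂ → ℝ} {A B : Trig → ℕ+ → ℝ}
    (hA : HasMultipoleExpansion f A) (hB : HasMultipoleExpansion g B)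
    (hfg : f =ᶠ[cobounded ℂ] g) : A = B := by
  obtain ⟨H, H0, hH, hf⟩ := hA.exists_hasFPowerSeriesAt
  obtain ⟨K, K0, hK, hg⟩ := hB.exists_hasFPowerSeriesAt
  have hre : ∀ᶠ w in 𝓝 (0 : ℂ), ((H - K) w).re = 0 := by
    have h1 : ∀ᶠ z in cobounded ℂ, ((H - K) z⁻¹).re = 0 := by
      filter_upwards [hf, hg, hfg] with z h1 h2 h3
      rw [Pi.sub_apply, Complex.sub_re, ← h1, ← h2, h3, sub_self]
    have h2 : ∀ᶠ w in 𝓝[≠] (0 : ℂ), ((H - K) w).re = 0 := by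
      filter_upwards [tendsto_inv₀_nhdsNE_zero.eventually h1] with w hw
      simpa using hw
    rw [eventually_nhdsWithin_iff] at h2
    filter_upwards [h2] with w hw
    by_cases h : w = 0
    · simp [h, H0, K0]
    · exact hw h
  have hD := hH.sub hK
  have hzero : ∀ᶠ w in 𝓝 (0 : ℂ), (H - K) w = 0 := by
    rcases hD.analyticAt.eventually_constant_or_nhds_le_map_nhds with h | h
    · filter_upwards [h] with w hw
      rw [hw, Pi.sub_apply, H0, K0, sub_self]
    · -- An open image would contain points off the imaginary axis.
      exfalso
      have h3 : ∀ᶠ w in 𝓝 ((H - K) 0), w.re = 0 := h hre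
      rw [Pi.sub_apply, H0, K0, sub_self] at h3
      obtain ⟨ε, hε, hb⟩ := Metric.eventually_nhds_iff_ball.1 h3
      have := hb ((ε / 2 : ℝ) : ℂ) (by
        rw [mem_ball_zero_iff, Complex.norm_real, Real.norm_eq_abs, abs_of_pos (by positivity)]
        linarith)
      rw [Complex.ofReal_re] at this
      linarith
  have hps := (hD.congr (g := 0) hzero).eq_zero
  have hco : ∀ k, laurentCoeff A k = laurentCoeff B k := fun k => by
    have := congrArg (fun p => FormalMultilinearSeries.coeff p k) hps
    simpa [FormalMultilinearSeries.coeff, FormalMultilinearSeries.ofScalars, sub_eq_zero] using this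
  rw [← multipoleCoeff_laurentCoeff A, ← multipoleCoeff_laurentCoeff B, funext hco]

/-! ### Gradients and Dirichlet integrals -/

theorem isOpen_exterior (Ω : Set ℂ) : IsOpen (exterior Ω) := isClosed_closure.isOpen_compl

theorem exterior_mem_cobounded {Ω : Set ℂ} (h : IsBounded Ω) : exterior Ω ∈ cobounded ℂ :=
  h.closure

theorem norm_gradient_eq (f : ℂ → ℝ) (z : ℂ) : ‖gradient f z‖ = ‖fderiv ℝ f z‖ :=
  LinearIsometryEquiv.norm_map _ _

theorem inner_gradient_gradient (u φ : ℂ → ℝ) (z : ℂ) :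
    inner ℝ (gradient u z) (gradient φ z) = fderiv ℝ φ z (gradient u z) := by
  rw [inner_gradient_right]
  rfl

theorem continuousOn_gradient {D : Set ℂ} (hD : IsOpen D) {f : ℂ → ℝ} (hf : ContDiffOn ℝ 1 f D) :
    ContinuousOn (gradient f) D :=
  (LinearIsometryEquiv.continuous _).comp_continuousOn (hf.continuousOn_fderiv_of_isOpen hD le_rfl)

/-- The product of a gradient that is locally square integrable up to the boundary with the gradient
of a test function is integrable. -/
theorem IsTestFunction.integrableOn_norm_mul_norm {D : Set ℂ} (hD : IsOpen D) {u φ : ℂ → ℝ}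
    (hu : ContDiffOn ℝ 1 u D)
    (hu2 : ∀ R : ℝ, IntegrableOn (fun z => ‖gradient u z‖ ^ 2) (D ∩ Metric.ball 0 R))
    (hφ : IsTestFunction D φ) :
    IntegrableOn (fun z => ‖gradient u z‖ * ‖gradient φ z‖) D := by
  obtain ⟨R, hR⟩ := hφ.bounded_support
  have hzero : ∀ z ∈ D, R < ‖z‖ → gradient φ z = 0 := by
    intro z hz hzR
    have h : φ =ᶠ[𝓝 z] fun _ => 0 := by
      filter_upwards [hD.mem_nhds hz,
        (isOpen_lt continuous_const continuous_norm).mem_nhds hzR] with y h1 h2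
      exact hR y h1 h2
    rw [h.gradient_eq, gradient_fun_const]
  have h1 : IntegrableOn ((Metric.ball (0 : ℂ) (R + 1)).indicator fun z => ‖gradient u z‖ ^ 2) D := by
    rw [integrableOn_indicator_iff measurableSet_ball, Set.inter_comm]
    exact hu2 _
  refine Integrable.mono' (h1.add hφ.gradient_sq_integrable) ?_ ?_
  · exact (((continuousOn_gradient hD hu).norm).mul
      ((continuousOn_gradient hD hφ.contDiffOn).norm)).aestronglyMeasurable hD.measurableSet
  · refine (ae_restrict_iff' hD.measurableSet).2 (Eventually.of_forall fun z hz => ?_)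
    rw [Real.norm_of_nonneg (by positivity)]
    by_cases h : z ∈ Metric.ball (0 : ℂ) (R + 1)
    · rw [Pi.add_apply, Set.indicator_of_mem h]
      nlinarith [sq_nonneg (‖gradient u z‖ - ‖gradient φ z‖), sq_nonneg ‖gradient u z‖,
        sq_nonneg ‖gradient φ z‖]
    · rw [Pi.add_apply, Set.indicator_of_notMem h, hzero z hz (by
        rw [mem_ball_zero_iff, not_lt] at h
        linarith)]
      simp

theorem IsTestFunction.integrableOn_inner {D : Set ℂ} (hD : IsOpen D) {u φ : ℂ → ℝ}
    (hu : ContDiffOn ℝ 1 u D)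
    (hu2 : ∀ R : ℝ, IntegrableOn (fun z => ‖gradient u z‖ ^ 2) (D ∩ Metric.ball 0 R))
    (hφ : IsTestFunction D φ) :
    IntegrableOn (fun z => inner ℝ (gradient u z) (gradient φ z)) D := by
  refine Integrable.mono' (hφ.integrableOn_norm_mul_norm hD hu hu2) ?_ ?_
  · exact ((continuousOn_gradient hD hu).inner
      (continuousOn_gradient hD hφ.contDiffOn)).aestronglyMeasurable hD.measurableSet
  · exact Eventually.of_forall fun z => norm_inner_le_norm _ _

theorem IsSolution.contDiffOn {Ω : Set ℂ} {h u : ℂ → ℝ} (hu : IsSolution Ω h u) :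
    ContDiffOn ℝ 1 u (exterior Ω) :=
  hu.harmonic.contDiffOn.of_le (by norm_num)

theorem IsSolution.differentiableAt {Ω : Set ℂ} {h u : ℂ → ℝ} (hu : IsSolution Ω h u) {z : ℂ}
    (hz : z ∈ exterior Ω) : DifferentiableAt ℝ u z :=
  (hu.contDiffOn.contDiffAt ((isOpen_exterior Ω).mem_nhds hz)).differentiableAt one_ne_zero

/-- The difference of two solutions for one background potential solves the problem with background
potential `0`. -/
theorem IsSolution.sub {Ω : Set ℂ} {h u v : ℂ → ℝ} (hu : IsSolution Ω h u)
    (hv : IsSolution Ω h v) : IsSolution Ω (fun _ => 0) (fun z => u z - v z) := by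
  have hD := isOpen_exterior Ω
  have hgrad : ∀ z ∈ exterior Ω,
      gradient (fun z => u z - v z) z = gradient u z - gradient v z := fun z hz => by
    rw [gradient, gradient, gradient, fderiv_fun_sub (hu.differentiableAt hz)
      (hv.differentiableAt hz), map_sub]
  have hcd : ContDiffOn ℝ 1 (fun z => u z - v z) (exterior Ω) := hu.contDiffOn.sub hv.contDiffOn
  have hmeas : ∀ R : ℝ, MeasurableSet (exterior Ω ∩ Metric.ball 0 R) := fun R =>
    hD.measurableSet.inter measurableSet_ball
  refine ⟨fun z hz => ?_, fun R => ?_, fun R => ?_, fun φ hφ => ?_, ?_⟩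
  · exact (hu.harmonic z hz).sub (hv.harmonic z hz)
  · refine Integrable.mono' (((hu.sq_integrable R).add (hv.sq_integrable R)).const_mul 2) ?_ ?_
    · exact ((hcd.continuousOn.mono Set.inter_subset_left).pow 2).aestronglyMeasurable (hmeas R)
    · refine Eventually.of_forall fun z => ?_
      rw [Real.norm_of_nonneg (by positivity)]
      simp only [Pi.add_apply]
      nlinarith [sq_nonneg (u z + v z)]
  · refine Integrable.mono'
      (((hu.gradient_sq_integrable R).add (hv.gradient_sq_integrable R)).const_mul 2) ?_ ?_
    · exact (((continuousOn_gradient hD hcd).norm.mono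
        Set.inter_subset_left).pow 2).aestronglyMeasurable (hmeas R)
    · refine (ae_restrict_iff' (hmeas R)).2 (Eventually.of_forall fun z hz => ?_)
      rw [Real.norm_of_nonneg (by positivity), hgrad z hz.1]
      simp only [Pi.add_apply]
      have h1 := norm_sub_le (gradient u z) (gradient v z)
      have h2 := norm_nonneg (gradient u z - gradient v z)
      nlinarith [sq_nonneg (‖gradient u z‖ - ‖gradient v z‖)]
  · have h1 : ∫ z in exterior Ω, inner ℝ (gradient (fun z => u z - v z) z) (gradient φ z)
        = ∫ z in exterior Ω, (inner ℝ (gradient u z) (gradient φ z)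
          - inner ℝ (gradient v z) (gradient φ z)) := by
      refine setIntegral_congr_fun hD.measurableSet fun z hz => ?_
      simp only [hgrad z hz, inner_sub_left]
    rw [h1, integral_sub (hφ.integrableOn_inner hD hu.contDiffOn hu.gradient_sq_integrable)
      (hφ.integrableOn_inner hD hv.contDiffOn hv.gradient_sq_integrable), hu.neumann φ hφ,
      hv.neumann φ hφ, sub_zero]
  · refine (hu.decay.sub hv.decay).congr_left fun z => ?_
    ring

/-! ### Uniqueness of the solution -/

/-- Smooth cutoffs at every scale `R`; the constant `C` in the gradient bound does not depend on
`R`. -/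
theorem exists_cutoff : ∃ C : ℝ, ∀ R : ℝ, 0 < R → ∃ η : ℂ → ℝ, ContDiff ℝ 1 η ∧
    (∀ z, ‖z‖ ≤ R → η z = 1) ∧ (∀ z, 2 * R ≤ ‖z‖ → η z = 0) ∧
    (∀ z, |η z| ≤ 1) ∧ ∀ z, ‖fderiv ℝ η z‖ ≤ C / R := by
  let b : ContDiffBump (0 : ℂ) := ⟨1, 2, one_pos, one_lt_two⟩
  obtain ⟨C, hC⟩ := (b.hasCompactSupport.fderiv ℝ).exists_bound_of_continuous
    ((b.contDiff (n := 1)).continuous_fderiv one_ne_zero)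
  refine ⟨C, fun R hR => ⟨fun z => b (R⁻¹ • z), ?_, ?_, ?_, ?_, ?_⟩⟩
  · exact b.contDiff.comp (contDiff_const_smul R⁻¹)
  · intro z hz
    refine b.one_of_mem_closedBall ?_
    rw [mem_closedBall_zero_iff, norm_smul, norm_inv, Real.norm_of_nonneg hR.le]
    exact (inv_mul_le_iff₀ hR).2 (hz.trans_eq (mul_one R).symm)
  · intro z hz
    refine b.zero_of_le_dist ?_
    rw [dist_zero_right, norm_smul, norm_inv, Real.norm_of_nonneg hR.le]
    exact (le_inv_mul_iff₀ hR).2 (by simpa [mul_comm] using hz)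
  · intro z
    rw [abs_of_nonneg b.nonneg]
    exact b.le_one
  · intro z
    have h : HasFDerivAt (fun z => b (R⁻¹ • z))
        ((fderiv ℝ b (R⁻¹ • z)).comp (R⁻¹ • ContinuousLinearMap.id ℝ ℂ)) z :=
      ((b.contDiff (n := 1)).differentiable one_ne_zero _).hasFDerivAt.comp z
        ((hasFDerivAt_id z).const_smul R⁻¹)
    rw [h.fderiv, ContinuousLinearMap.comp_smul, ContinuousLinearMap.comp_id, norm_smul, norm_inv,
      Real.norm_of_nonneg hR.le, div_eq_inv_mul]
    gcongr
    exact hC _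

/-- The Caccioppoli inequality for a solution without background potential, from the test function
`η² w`. -/
theorem IsSolution.caccioppoli {Ω : Set ℂ} {w η : ℂ → ℝ} (hw : IsSolution Ω (fun _ => 0) w)
    (hη : ContDiff ℝ 1 η) {R C : ℝ} (hsupp : ∀ z, R ≤ ‖z‖ → η z = 0)
    (hη1 : ∀ z, |η z| ≤ 1) (hηC : ∀ z, ‖fderiv ℝ η z‖ ≤ C) :
    IntegrableOn (fun z => η z ^ 2 * ‖gradient w z‖ ^ 2) (exterior Ω) ∧
    IntegrableOn (fun z => w z ^ 2 * ‖fderiv ℝ η z‖ ^ 2) (exterior Ω) ∧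
    ∫ z in exterior Ω, η z ^ 2 * ‖gradient w z‖ ^ 2
      ≤ 4 * ∫ z in exterior Ω, w z ^ 2 * ‖fderiv ℝ η z‖ ^ 2 := by
  have hD := isOpen_exterior Ω
  have hC : 0 ≤ C := (norm_nonneg _).trans (hηC 0)
  have hcw := hw.contDiffOn
  have hcη : ContDiffOn ℝ 1 η (exterior Ω) := hη.contDiffOn
  have hη0 : ∀ z, R < ‖z‖ → η z = 0 ∧ fderiv ℝ η z = 0 := by
    intro z hz
    refine ⟨hsupp z hz.le, ?_⟩
    have h : η =ᶠ[𝓝 z] fun _ => 0 := by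
      filter_upwards [(isOpen_lt continuous_const continuous_norm).mem_nhds hz] with y h2
      exact hsupp y (le_of_lt h2)
    rw [h.fderiv_eq, fderiv_fun_const]
    rfl
  -- Every integrand is dominated by a multiple of `w² + ‖∇w‖²` on a disc and vanishes off it.
  have hdom : ∀ (K : ℝ) (g : ℂ → ℝ), ContinuousOn g (exterior Ω) →
      (∀ z ∈ exterior Ω, |g z| ≤ K * (w z ^ 2 + ‖gradient w z‖ ^ 2)) →
      (∀ z ∈ exterior Ω, R < ‖z‖ → g z = 0) → IntegrableOn g (exterior Ω) := by
    intro K g hg hb h0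
    have h1 : IntegrableOn ((Metric.ball (0 : ℂ) (R + 1)).indicator
        fun z => K * (w z ^ 2 + ‖gradient w z‖ ^ 2)) (exterior Ω) := by
      rw [integrableOn_indicator_iff measurableSet_ball, Set.inter_comm]
      exact ((hw.sq_integrable _).add (hw.gradient_sq_integrable _)).const_mul _
    refine Integrable.mono' h1 (hg.aestronglyMeasurable hD.measurableSet) ?_
    refine (ae_restrict_iff' hD.measurableSet).2 (Eventually.of_forall fun z hz => ?_)
    by_cases h : z ∈ Metric.ball (0 : ℂ) (R + 1)
    · rw [Set.indicator_of_mem h]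
      exact hb z hz
    · rw [Set.indicator_of_notMem h, h0 z hz (by
        rw [mem_ball_zero_iff, not_lt] at h
        linarith)]
      simp
  have hfd : ∀ z ∈ exterior Ω, HasFDerivAt (fun z => η z ^ 2 * w z)
      (η z ^ 2 • fderiv ℝ w z + w z • ((2 * η z) • fderiv ℝ η z)) z := by
    intro z hz
    have h1 := (hη.differentiable one_ne_zero z).hasFDerivAt
    have h2 := (hw.differentiableAt hz).hasFDerivAt
    refine ((h1.pow 2).mul h2).congr_fderiv ?_
    simp
  have hη2 : ∀ z, η z ^ 2 ≤ 1 := fun z => by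
    rw [← sq_abs]
    exact pow_le_one₀ (abs_nonneg _) (hη1 z)
  have htest : IsTestFunction (exterior Ω) (fun z => η z ^ 2 * w z) := by
    have hcd : ContDiffOn ℝ 1 (fun z => η z ^ 2 * w z) (exterior Ω) := (hcη.pow 2).mul hcw
    refine ⟨hcd, ⟨R, fun z _ hz => by simp [hsupp z hz.le]⟩, ?_, ?_⟩
    · refine hdom 1 _ (hcd.continuousOn.pow 2) (fun z hz => ?_) (fun z hz hzR => by
        simp [hsupp z hzR.le])
      rw [abs_of_nonneg (by positivity), mul_pow, one_mul]
      have h1 : (η z ^ 2) ^ 2 ≤ 1 := pow_le_one₀ (by positivity) (hη2 z)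
      nlinarith [sq_nonneg (w z), sq_nonneg ‖gradient w z‖]
    · refine hdom (2 + 8 * C ^ 2) _ ((continuousOn_gradient hD hcd).norm.pow 2) (fun z hz => ?_)
        (fun z hz hzR => ?_)
      · rw [abs_of_nonneg (by positivity), norm_gradient_eq, norm_gradient_eq, (hfd z hz).fderiv]
        have h1 : ‖η z ^ 2 • fderiv ℝ w z + w z • ((2 * η z) • fderiv ℝ η z)‖
            ≤ ‖fderiv ℝ w z‖ + |w z| * (2 * C) := by
          refine (norm_add_le _ _).trans (add_le_add ?_ ?_)
          · rw [norm_smul, Real.norm_of_nonneg (by positivity)]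
            exact mul_le_of_le_one_left (norm_nonneg _) (hη2 z)
          · rw [norm_smul, norm_smul, Real.norm_eq_abs, norm_mul, Real.norm_eq_abs, Real.norm_eq_abs,
              abs_two]
            gcongr
            · nlinarith [hη1 z]
            · exact hηC z
        refine (pow_le_pow_left₀ (norm_nonneg _) h1 2).trans ?_
        have h2 : w z ^ 2 = |w z| ^ 2 := (sq_abs _).symm
        rw [h2]
        nlinarith [sq_nonneg (‖fderiv ℝ w z‖ - |w z| * (2 * C)), sq_nonneg (|w z|),
          mul_nonneg (sq_nonneg C) (sq_nonneg ‖fderiv ℝ w z‖)]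
      · rw [norm_gradient_eq, (hfd z hz).fderiv, (hη0 z hzR).1, (hη0 z hzR).2]
        simp
  have hi1 : IntegrableOn (fun z => η z ^ 2 * ‖gradient w z‖ ^ 2) (exterior Ω) := by
    refine hdom 1 _ ((hcη.continuousOn.pow 2).mul ((continuousOn_gradient hD hcw).norm.pow 2))
      (fun z _ => ?_) (fun z _ hzR => by simp [hsupp z hzR.le])
    rw [abs_of_nonneg (by positivity)]
    nlinarith [hη2 z, sq_nonneg (w z), sq_nonneg ‖gradient w z‖]
  have hi2 : IntegrableOn (fun z => w z ^ 2 * ‖fderiv ℝ η z‖ ^ 2) (exterior Ω) := by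
    refine hdom (C ^ 2) _ ((hcw.continuousOn.pow 2).mul
      ((hη.continuous_fderiv one_ne_zero).continuousOn.norm.pow 2))
      (fun z _ => ?_) (fun z _ hzR => by simp [(hη0 z hzR).2])
    rw [abs_of_nonneg (by positivity)]
    have := pow_le_pow_left₀ (norm_nonneg _) (hηC z) 2
    nlinarith [sq_nonneg (w z), mul_nonneg (sq_nonneg C) (sq_nonneg ‖gradient w z‖)]
  refine ⟨hi1, hi2, ?_⟩
  have hi3 := htest.integrableOn_inner hD hcw hw.gradient_sq_integrable
  have hle : ∫ z in exterior Ω, η z ^ 2 * ‖gradient w z‖ ^ 2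
      ≤ ∫ z in exterior Ω, (2 * inner ℝ (gradient w z) (gradient (fun z => η z ^ 2 * w z) z)
        + 4 * (w z ^ 2 * ‖fderiv ℝ η z‖ ^ 2)) := by
    refine setIntegral_mono_on hi1 ((hi3.const_mul 2).add (hi2.const_mul 4)) hD.measurableSet
      fun z hz => ?_
    rw [inner_gradient_gradient, (hfd z hz).fderiv]
    have h1 : fderiv ℝ w z (gradient w z) = ‖gradient w z‖ ^ 2 := by
      rw [← inner_gradient_left, real_inner_self_eq_norm_sq]
    have h2 : |fderiv ℝ η z (gradient w z)| ≤ ‖fderiv ℝ η z‖ * ‖gradient w z‖ :=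
      (fderiv ℝ η z).le_opNorm _
    simp only [add_apply, smul_apply, smul_eq_mul, h1]
    have h3 : |w z * (η z * fderiv ℝ η z (gradient w z))|
        ≤ |w z| * (|η z| * (‖fderiv ℝ η z‖ * ‖gradient w z‖)) := by
      rw [abs_mul, abs_mul]
      gcongr
    have h4 := neg_le_of_abs_le h3
    have h5 := sq_nonneg (|η z| * ‖gradient w z‖ - 2 * |w z| * ‖fderiv ℝ η z‖)
    rw [sub_sq, mul_pow, mul_pow, mul_pow, sq_abs, sq_abs] at h5
    nlinarith
  rwa [integral_add (hi3.const_mul 2) (hi2.const_mul 4), integral_const_mul, integral_const_mul,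
    hw.neumann _ htest, mul_zero, zero_add] at hle

/-- The solution without background potential vanishes: by the Caccioppoli inequality on large
discs its Dirichlet integral is zero. -/
theorem IsSolution.eqOn_zero {Ω : Set ℂ} {w : ℂ → ℝ} (hw : IsSolution Ω (fun _ => 0) w)
    (hbdd : IsBounded Ω) (hconn : IsPreconnected (exterior Ω)) : ∀ z ∈ exterior Ω, w z = 0 := by
  have hD := isOpen_exterior Ω
  obtain ⟨C, hcut⟩ := exists_cutoff
  obtain ⟨K, hK⟩ := hw.decay.bound
  obtain ⟨R₀, hR₀, hdec⟩ := eventually_cobounded_iff.1 hK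
  have hbound : ∀ R, R₀ < R → ∀ r, r ≤ R →
      ∫ z in exterior Ω ∩ Metric.ball 0 r, ‖gradient w z‖ ^ 2
        ≤ 16 * Real.pi * (C ^ 2 * K ^ 2) * (R⁻¹) ^ 2 := by
    intro R hR r hr
    have hRpos : 0 < R := hR₀.trans hR
    obtain ⟨η, hη, hη1, hη2, hηa, hηC⟩ := hcut R hRpos
    obtain ⟨hi1, hi2, hle⟩ := hw.caccioppoli hη hη2 hηa hηC
    have h1 : ∫ z in exterior Ω ∩ Metric.ball 0 r, ‖gradient w z‖ ^ 2
        ≤ ∫ z in exterior Ω, η z ^ 2 * ‖gradient w z‖ ^ 2 := by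
      have h2 : ∫ z in exterior Ω ∩ Metric.ball 0 r, ‖gradient w z‖ ^ 2
          = ∫ z in exterior Ω ∩ Metric.ball 0 r, η z ^ 2 * ‖gradient w z‖ ^ 2 := by
        refine setIntegral_congr_fun (hD.measurableSet.inter measurableSet_ball) fun z hz => ?_
        have : ‖z‖ ≤ R := (mem_ball_zero_iff.1 hz.2).le.trans hr
        simp [hη1 z this]
      rw [h2]
      exact setIntegral_mono_set hi1 (Eventually.of_forall fun z => by positivity)
        (Eventually.of_forall fun z hz => hz.1)
    have h3 : ∫ z in exterior Ω, w z ^ 2 * ‖fderiv ℝ η z‖ ^ 2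
        ≤ 4 * Real.pi * (C ^ 2 * K ^ 2) * (R⁻¹) ^ 2 := by
      -- On the support of `∇η`, `w` is at most `K / R` and `∇η` at most `C / R`.
      have hpt : ∀ z ∈ exterior Ω, w z ^ 2 * ‖fderiv ℝ η z‖ ^ 2 ≤
          (Metric.closedBall (0 : ℂ) (2 * R)).indicator
            (fun _ => C ^ 2 * K ^ 2 * (R⁻¹) ^ 4) z := by
        intro z _
        by_cases hz1 : ‖z‖ < R
        · have h : η =ᶠ[𝓝 z] fun _ => 1 := by
            filter_upwards [(isOpen_lt continuous_norm continuous_const).mem_nhds hz1] with y hy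
            exact hη1 y (le_of_lt hy)
          rw [h.fderiv_eq, fderiv_fun_const]
          simp only [Pi.zero_apply, norm_zero, ne_eq, OfNat.ofNat_ne_zero, not_false_eq_true,
            zero_pow, mul_zero]
          exact Set.indicator_nonneg (fun _ _ => by positivity) _
        by_cases hz2 : 2 * R < ‖z‖
        · have h : η =ᶠ[𝓝 z] fun _ => 0 := by
            filter_upwards [(isOpen_lt continuous_const continuous_norm).mem_nhds hz2] with y hy
            exact hη2 y (le_of_lt hy)
          rw [h.fderiv_eq, fderiv_fun_const]
          simp only [Pi.zero_apply, norm_zero, ne_eq, OfNat.ofNat_ne_zero, not_false_eq_true,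
            zero_pow, mul_zero]
          exact Set.indicator_nonneg (fun _ _ => by positivity) _
        rw [Set.indicator_of_mem (by rw [mem_closedBall_zero_iff]; exact not_lt.1 hz2)]
        have hzR : R ≤ ‖z‖ := not_lt.1 hz1
        have hwK : ‖w z‖ ≤ |K| * R⁻¹ := by
          have h4 := hdec z (hR.trans_le hzR)
          simp only [sub_zero, norm_inv, norm_norm] at h4
          refine h4.trans ?_
          gcongr
          exact le_abs_self K
        have h5 : w z ^ 2 ≤ K ^ 2 * (R⁻¹) ^ 2 := by
          rw [← sq_abs, ← sq_abs K, ← mul_pow]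
          exact pow_le_pow_left₀ (abs_nonneg _) hwK 2
        have h6 : ‖fderiv ℝ η z‖ ^ 2 ≤ C ^ 2 * (R⁻¹) ^ 2 := by
          rw [← mul_pow, ← div_eq_mul_inv]
          exact pow_le_pow_left₀ (norm_nonneg _) (hηC z) 2
        calc w z ^ 2 * ‖fderiv ℝ η z‖ ^ 2 ≤ (K ^ 2 * (R⁻¹) ^ 2) * (C ^ 2 * (R⁻¹) ^ 2) := by gcongr
          _ = C ^ 2 * K ^ 2 * (R⁻¹) ^ 4 := by ring
      have hint : Integrable ((Metric.closedBall (0 : ℂ) (2 * R)).indicator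
          (fun _ => C ^ 2 * K ^ 2 * (R⁻¹) ^ 4)) := by
        rw [integrable_indicator_iff measurableSet_closedBall]
        exact integrableOn_const (measure_closedBall_lt_top).ne
      calc ∫ z in exterior Ω, w z ^ 2 * ‖fderiv ℝ η z‖ ^ 2
          ≤ ∫ z in exterior Ω, (Metric.closedBall (0 : ℂ) (2 * R)).indicator
            (fun _ => C ^ 2 * K ^ 2 * (R⁻¹) ^ 4) z :=
            setIntegral_mono_on hi2 hint.integrableOn hD.measurableSet hpt
        _ ≤ ∫ z, (Metric.closedBall (0 : ℂ) (2 * R)).indicator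
            (fun _ => C ^ 2 * K ^ 2 * (R⁻¹) ^ 4) z :=
            setIntegral_le_integral hint (Eventually.of_forall fun z =>
              Set.indicator_nonneg (fun _ _ => by positivity) _)
        _ = 4 * Real.pi * (C ^ 2 * K ^ 2) * (R⁻¹) ^ 2 := by
            rw [integral_indicator measurableSet_closedBall, setIntegral_const, Measure.real,
              Complex.volume_closedBall]
            simp [ENNReal.toReal_ofReal hRpos.le]
            field_simp
            ring
    linarith
  have hzero : ∀ r, ∫ z in exterior Ω ∩ Metric.ball 0 r, ‖gradient w z‖ ^ 2 = 0 := by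
    intro r
    refine le_antisymm ?_ (integral_nonneg fun z => by positivity)
    have hlim : Tendsto (fun R : ℝ => 16 * Real.pi * (C ^ 2 * K ^ 2) * (R⁻¹) ^ 2) atTop (𝓝 0) := by
      have h := (tendsto_inv_atTop_zero (𝕜 := ℝ).pow 2).const_mul
        (16 * Real.pi * (C ^ 2 * K ^ 2))
      rwa [zero_pow two_ne_zero, mul_zero] at h
    refine ge_of_tendsto hlim ?_
    filter_upwards [eventually_gt_atTop R₀, eventually_ge_atTop r] with R h1 h2
    exact hbound R h1 r h2
  have hgrad : ∀ z ∈ exterior Ω, fderiv ℝ w z = 0 := by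
    intro z hz
    have hz' : z ∈ exterior Ω ∩ Metric.ball 0 (‖z‖ + 1) := ⟨hz, by simp⟩
    have hcont := ((continuousOn_gradient hD hw.contDiffOn).norm.pow 2).mono
      (Set.inter_subset_left (t := Metric.ball 0 (‖z‖ + 1)))
    have h1 := (setIntegral_eq_zero_iff_of_nonneg_ae (Eventually.of_forall fun z => by positivity)
      (hw.gradient_sq_integrable (‖z‖ + 1))).1 (hzero (‖z‖ + 1))
    have h2 := Measure.eqOn_open_of_ae_eq h1 (hD.inter Metric.isOpen_ball) hcont
      continuousOn_const hz'
    rw [← norm_eq_zero, ← norm_gradient_eq]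
    exact pow_eq_zero_iff two_ne_zero |>.1 h2
  obtain ⟨a, ha⟩ := hD.exists_is_const_of_fderiv_eq_zero (𝕜 := ℝ) hconn
    (fun z hz => (hw.differentiableAt hz).differentiableWithinAt) hgrad
  have hlim : Tendsto w (cobounded ℂ) (𝓝 0) := by
    have h1 : Tendsto (fun z : ℂ => ‖z‖⁻¹) (cobounded ℂ) (𝓝 0) :=
      tendsto_inv_atTop_zero.comp tendsto_norm_cobounded_atTop
    simpa using hw.decay.trans_tendsto h1
  have hlim' : Tendsto w (cobounded ℂ) (𝓝 a) := by
    refine tendsto_const_nhds.congr' ?_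
    filter_upwards [exterior_mem_cobounded hbdd] with z hz
    exact (ha z hz).symm
  intro z hz
  rw [ha z hz]
  exact tendsto_nhds_unique hlim' hlim

/-- The contracted GPTs of `Ω` are the multipole coefficients of any response. -/
theorem contractedGPT_eq {Ω : Set ℂ} (hbdd : IsBounded Ω) (hconn : IsPreconnected (exterior Ω))
    {β : Trig} {n : ℕ+} {A : Trig → ℕ+ → ℝ} (hA : IsResponse Ω β n A) (α : Trig) (m : ℕ+) :
    contractedGPT Ω α β m n = A α m := by
  have hex : ∃ A, IsResponse Ω β n A := ⟨A, hA⟩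
  rw [contractedGPT, dif_pos hex]
  obtain ⟨u, hu, hu'⟩ := hex.choose_spec
  obtain ⟨v, hv, hv'⟩ := hA
  rw [hu'.unique hv' ?_]
  filter_upwards [exterior_mem_cobounded hbdd] with z hz
  rw [sub_left_inj]
  exact sub_eq_zero.1 ((hu.sub hv).eqOn_zero hbdd hconn z hz)

/-! ### The weak Neumann condition from the stream function -/

/-- The boundary of `D` contributes nothing when `G` is supported on a compact subset of `D`: then
`G`, extended by zero, is `C¹` with compact support on the whole plane. -/
theorem setIntegral_fderiv_eq_zero {D K : Set ℂ} (hD : IsOpen D) (hK : IsCompact K) (hKD : K ⊆ D)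
    {G : ℂ → ℝ} (hG : ContDiffOn ℝ 1 G D) (h0 : ∀ z ∈ D, z ∉ K → G z = 0) (v : ℂ) :
    IntegrableOn (fun z => fderiv ℝ G z v) D ∧ ∫ z in D, fderiv ℝ G z v = 0 := by
  have hin : ∀ z ∈ D, D.indicator G =ᶠ[𝓝 z] G := fun z hz => by
    filter_upwards [hD.mem_nhds hz] with y hy
    exact Set.indicator_of_mem hy G
  have hout : ∀ z ∉ K, D.indicator G =ᶠ[𝓝 z] fun _ => 0 := fun z hz => by
    filter_upwards [hK.isClosed.isOpen_compl.mem_nhds hz] with y hy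
    by_cases hyD : y ∈ D
    · rw [Set.indicator_of_mem hyD, h0 y hyD hy]
    · exact Set.indicator_of_notMem hyD G
  have hcd : ContDiff ℝ 1 (D.indicator G) := by
    rw [contDiff_iff_contDiffAt]
    intro z
    by_cases hz : z ∈ D
    · exact (hG.contDiffAt (hD.mem_nhds hz)).congr_of_eventuallyEq (hin z hz)
    · exact contDiffAt_const.congr_of_eventuallyEq (hout z fun h => hz (hKD h))
  have hsupp : HasCompactSupport (D.indicator G) :=
    HasCompactSupport.intro hK fun z hz => (hout z hz).self_of_nhds
  have hfd : (fun z => fderiv ℝ (D.indicator G) z v) = D.indicator fun z => fderiv ℝ G z v := by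
    funext z
    by_cases hz : z ∈ D
    · rw [Set.indicator_of_mem hz, (hin z hz).fderiv_eq]
    · rw [Set.indicator_of_notMem hz, (hout z fun h => hz (hKD h)).fderiv_eq, fderiv_fun_const]
      rfl
  have hint : Integrable (fun z => fderiv ℝ (D.indicator G) z v) :=
    ((hcd.continuous_fderiv one_ne_zero).clm_apply continuous_const).integrable_of_hasCompactSupport
      (hsupp.fderiv_apply ℝ v)
  have hibp := integral_mul_fderiv_eq_neg_fderiv_mul_of_integrable (μ := volume) (𝕜 := ℝ) (v := v)
    (f := fun _ => 1) (g := D.indicator G) (by simp) (by simpa using hint)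
    (by simpa using hcd.continuous.integrable_of_hasCompactSupport hsupp)
    (fun z _ => differentiableAt_const _)
    (fun z _ => hcd.differentiable one_ne_zero z)
  simp only [one_mul, fderiv_fun_const, Pi.zero_apply, zero_apply, zero_mul,
    integral_zero, neg_zero] at hibp
  rw [hfd] at hint hibp
  exact ⟨(integrable_indicator_iff hD.measurableSet).1 hint,
    by rwa [integral_indicator hD.measurableSet] at hibp⟩

theorem gradient_re {W : ℂ → ℂ} {z : ℂ} (hW : DifferentiableAt ℂ W z) :
    gradient (fun z => (W z).re) z = conj (deriv W z) := by
  refine ext_inner_right ℝ fun v => ?_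
  have h : HasFDerivAt (fun z => (W z).re) _ z :=
    Complex.reCLM.hasFDerivAt.comp z hW.hasDerivAt.complexToReal_fderiv
  rw [inner_gradient_left, h.fderiv, Complex.inner]
  simp
  ring

/-- Multiplying `∇ Re W` by a function `τ` of the stream function `Im W - κ` preserves its being
divergence free, so the integral against `∇φ` vanishes as soon as `τ` cuts off the boundary. -/
theorem setIntegral_comp_stream_mul_inner_eq_zero {D K : Set ℂ} (hD : IsOpen D)
    (hK : IsCompact K) (hKD : K ⊆ D) {W : ℂ → ℂ} (hW : DifferentiableOn ℂ W D) (κ : ℝ)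
    {φ : ℂ → ℝ} (hφ : ContDiffOn ℝ 1 φ D) {τ : ℝ → ℝ} (hτ : ContDiff ℝ 1 τ)
    (h0 : ∀ z ∈ D, z ∉ K → φ z * τ ((W z).im - κ) = 0) :
    ∫ z in D, τ ((W z).im - κ) * inner ℝ (gradient (fun z => (W z).re) z) (gradient φ z) = 0 := by
  have hW' : DifferentiableOn ℂ (deriv W) D := hW.deriv hD
  have hWc : ContDiffOn ℝ 1 W D := (hW.contDiffOn hD).restrict_scalars ℝ
  have hWc' : ContDiffOn ℝ 1 (deriv W) D := (hW'.contDiffOn hD).restrict_scalars ℝ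
  have hs : ContDiffOn ℝ 1 (fun z => τ ((W z).im - κ)) D :=
    hτ.comp_contDiffOn ((Complex.imCLM.contDiff.comp_contDiffOn hWc).sub contDiffOn_const)
  have h1 := setIntegral_fderiv_eq_zero hD hK hKD
    (G := fun z => φ z * τ ((W z).im - κ) * (deriv W z).re)
    ((hφ.mul hs).mul (Complex.reCLM.contDiff.comp_contDiffOn hWc'))
    (fun z hz hzK => by rw [h0 z hz hzK, zero_mul]) 1
  have h2 := setIntegral_fderiv_eq_zero hD hK hKD
    (G := fun z => φ z * τ ((W z).im - κ) * (deriv W z).im)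
    ((hφ.mul hs).mul (Complex.imCLM.contDiff.comp_contDiffOn hWc'))
    (fun z hz hzK => by rw [h0 z hz hzK, zero_mul]) Complex.I
  -- The integrand is `∂₁ (φ τ(s) Re W') - ∂₂ (φ τ(s) Im W')`; the terms with `W''` and with `τ'`
  -- cancel by the Cauchy-Riemann equations.
  rw [← sub_zero (0 : ℝ)]
  nth_rw 1 [← h1.2]
  nth_rw 1 [← h2.2]
  rw [← integral_sub h1.1 h2.1]
  refine setIntegral_congr_fun hD.measurableSet fun z hz => ?_
  have hWz := (hW.differentiableAt (hD.mem_nhds hz)).hasDerivAt.complexToReal_fderiv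
  have hWz' := (hW'.differentiableAt (hD.mem_nhds hz)).hasDerivAt.complexToReal_fderiv
  have hφz := ((hφ.contDiffAt (hD.mem_nhds hz)).differentiableAt one_ne_zero).hasFDerivAt
  have hsz : HasFDerivAt (fun z => (W z).im - κ) _ z :=
    (Complex.imCLM.hasFDerivAt.comp z hWz).sub_const κ
  have hτz : HasFDerivAt (fun z => τ ((W z).im - κ)) _ z :=
    ((hτ.differentiable one_ne_zero _).hasDerivAt).comp_hasFDerivAt z hsz
  have hre : HasFDerivAt (fun z => (deriv W z).re) _ z := Complex.reCLM.hasFDerivAt.comp z hWz'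
  have him : HasFDerivAt (fun z => (deriv W z).im) _ z := Complex.imCLM.hasFDerivAt.comp z hWz'
  have hF1 : HasFDerivAt (fun z => φ z * τ ((W z).im - κ) * (deriv W z).re) _ z :=
    (hφz.mul hτz).mul hre
  have hF2 : HasFDerivAt (fun z => φ z * τ ((W z).im - κ) * (deriv W z).im) _ z :=
    (hφz.mul hτz).mul him
  simp only [hF1.fderiv, hF2.fderiv]
  rw [inner_gradient_gradient, gradient_re (hW.differentiableAt (hD.mem_nhds hz))]
  have hconj : fderiv ℝ φ z (conj (deriv W z)) =
      (deriv W z).re * fderiv ℝ φ z 1 - (deriv W z).im * fderiv ℝ φ z Complex.I := by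
    have : conj (deriv W z) = (deriv W z).re • (1 : ℂ) - (deriv W z).im • Complex.I := by
      apply Complex.ext <;> simp
    rw [this, map_sub, map_smul, map_smul, smul_eq_mul, smul_eq_mul]
  rw [hconj]
  simp
  ring

/-- If the stream function `Im W - κ` tends to `0` at the boundary of `D`, then `Re W` satisfies the
weak Neumann condition on `D`. -/
theorem setIntegral_inner_gradient_re_eq_zero {D : Set ℂ} (hD : IsOpen D) {W : ℂ → ℂ}
    (hW : DifferentiableOn ℂ W D) (κ : ℝ)
    (hL2 : ∀ R : ℝ, IntegrableOn (fun z => ‖gradient (fun z => (W z).re) z‖ ^ 2)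
      (D ∩ Metric.ball 0 R))
    (hbdry : ∀ ε > 0, ∀ R : ℝ, ∃ K ⊆ D, IsCompact K ∧
      ∀ z ∈ D, z ∉ K → |(W z).im - κ| < ε ∨ R < ‖z‖)
    (hnull : volume {z ∈ D | (W z).im - κ = 0} = 0)
    {φ : ℂ → ℝ} (hφ : IsTestFunction D φ) :
    ∫ z in D, inner ℝ (gradient (fun z => (W z).re) z) (gradient φ z) = 0 := by
  have hWc : ContDiffOn ℝ 1 W D := (hW.contDiffOn hD).restrict_scalars ℝ
  have huc : ContDiffOn ℝ 1 (fun z => (W z).re) D := Complex.reCLM.contDiff.comp_contDiffOn hWc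
  have hsc : ContinuousOn (fun z => (W z).im - κ) D :=
    (Complex.continuous_im.comp_continuousOn hWc.continuousOn).sub continuousOn_const
  -- `τ n t` is `0` for `|t| ≤ 1 / n` and `1` for `|t| ≥ 2 / n`.
  let τ : ℕ → ℝ → ℝ := fun n t => Real.smoothTransition ((n * t) ^ 2 - 1)
  have hτ : ∀ n, ContDiff ℝ 1 (τ n) := fun n =>
    Real.smoothTransition.contDiff.comp (by fun_prop)
  obtain ⟨R, hR⟩ := hφ.bounded_support
  have hzero : ∀ n : ℕ, ∫ z in D, τ n ((W z).im - κ) *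
      inner ℝ (gradient (fun z => (W z).re) z) (gradient φ z) = 0 := by
    intro n
    obtain ⟨K, hKD, hK, hKs⟩ := hbdry (1 / (n + 1)) (by positivity) R
    refine setIntegral_comp_stream_mul_inner_eq_zero hD hK hKD hW κ hφ.contDiffOn (hτ n)
      fun z hz hzK => ?_
    rcases hKs z hz hzK with h | h
    · have h1 : τ n ((W z).im - κ) = 0 := by
        refine Real.smoothTransition.zero_of_nonpos ?_
        rw [lt_div_iff₀ (by positivity)] at h
        have h2 : |n * ((W z).im - κ)| ≤ 1 := by
          rw [abs_mul, Nat.abs_cast]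
          nlinarith [abs_nonneg ((W z).im - κ)]
        have h3 := pow_le_pow_left₀ (abs_nonneg _) h2 2
        rw [sq_abs] at h3
        linarith
      rw [h1, mul_zero]
    · rw [hR z hz h, zero_mul]
  have hlim : Tendsto (fun n => ∫ z in D, τ n ((W z).im - κ) *
      inner ℝ (gradient (fun z => (W z).re) z) (gradient φ z)) atTop
      (𝓝 (∫ z in D, inner ℝ (gradient (fun z => (W z).re) z) (gradient φ z))) := by
    refine tendsto_integral_of_dominated_convergence
      (fun z => ‖gradient (fun z => (W z).re) z‖ * ‖gradient φ z‖) (fun n => ?_)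
      (hφ.integrableOn_norm_mul_norm hD huc hL2) (fun n => ?_) ?_
    · exact (((hτ n).continuous.comp_continuousOn hsc).mul ((continuousOn_gradient hD huc).inner
        (continuousOn_gradient hD hφ.contDiffOn))).aestronglyMeasurable hD.measurableSet
    · refine Eventually.of_forall fun z => ?_
      rw [norm_mul]
      refine (mul_le_of_le_one_left (norm_nonneg _) ?_).trans (norm_inner_le_norm _ _)
      rw [Real.norm_of_nonneg (Real.smoothTransition.nonneg _)]
      exact Real.smoothTransition.le_one _
    · have hne : ∀ᵐ z ∂volume.restrict D, (W z).im - κ ≠ 0 := by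
        rw [ae_restrict_iff' hD.measurableSet, ae_iff]
        simpa using hnull
      filter_upwards [hne] with z hz
      refine tendsto_const_nhds.congr' ?_
      have h1 : Tendsto (fun n : ℕ => (n * |(W z).im - κ|)) atTop atTop :=
        tendsto_natCast_atTop_atTop.atTop_mul_const (abs_pos.2 hz)
      filter_upwards [h1.eventually_ge_atTop 2] with n hn
      have h2 : τ n ((W z).im - κ) = 1 := by
        refine Real.smoothTransition.one_of_one_le ?_
        rw [← sq_abs, abs_mul, Nat.abs_cast]
        nlinarith
      rw [h2, one_mul]
  simp only [hzero] at hlim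
  exact (tendsto_nhds_unique tendsto_const_nhds hlim).symm

/-! ### The exterior conformal map and its inverse -/

/-- The inverse of the exterior map, `exteriorInverse Φ : exterior Ω → {|ζ| > 1}`. -/
noncomputable def exteriorInverse (Φ : ℂ → ℂ) : ℂ → ℂ := Function.invFunOn Φ {ζ | 1 < ‖ζ‖}

/-- The function `w ↦ ∑ μₖ wᵏ`, so that `Φ ζ = c ζ + laurentTail μ ζ⁻¹`. -/
noncomputable def laurentTail (μ : ℕ → ℂ) (w : ℂ) : ℂ := ∑' k, μ k * w ^ k

theorem isOpen_one_lt_norm : IsOpen {ζ : ℂ | 1 < ‖ζ‖} := isOpen_lt continuous_const continuous_norm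

/-- The exterior of the unit disc is the image of the right half-plane under `exp`. -/
theorem isPreconnected_one_lt_norm : IsPreconnected {ζ : ℂ | 1 < ‖ζ‖} := by
  have h : {ζ : ℂ | 1 < ‖ζ‖} = Complex.exp '' {w | 0 < w.re} := by
    ext ζ
    constructor
    · intro hζ
      have h0 : ζ ≠ 0 := norm_pos_iff.1 (zero_lt_one.trans hζ)
      exact ⟨Complex.log ζ, by simpa [Complex.log_re] using Real.log_pos hζ, Complex.exp_log h0⟩
    · rintro ⟨w, hw, rfl⟩
      simpa [Complex.norm_exp] using hw
  rw [h]
  exact (convex_halfSpace_re_gt 0).isPreconnected.image _ Complex.continuous_exp.continuousOn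

section

variable {Ω : Set ℂ} {Φ : ℂ → ℂ} {c : ℝ} {μ : ℕ → ℂ}

theorem IsExteriorMap.analyticAt (hΦ : IsExteriorMap Ω Φ c μ) {ζ : ℂ} (hζ : 1 < ‖ζ‖) :
    AnalyticAt ℂ Φ ζ :=
  hΦ.holomorphic.analyticAt (isOpen_one_lt_norm.mem_nhds hζ)

theorem IsExteriorMap.isPreconnected_exterior (hΦ : IsExteriorMap Ω Φ c μ) :
    IsPreconnected (exterior Ω) := by
  rw [← hΦ.bijOn.image_eq]
  exact isPreconnected_one_lt_norm.image _ hΦ.holomorphic.continuousOn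

theorem IsExteriorMap.one_lt_norm_inverse (hΦ : IsExteriorMap Ω Φ c μ) {z : ℂ}
    (hz : z ∈ exterior Ω) : 1 < ‖exteriorInverse Φ z‖ :=
  hΦ.bijOn.surjOn.mapsTo_invFunOn hz

theorem IsExteriorMap.apply_inverse (hΦ : IsExteriorMap Ω Φ c μ) {z : ℂ}
    (hz : z ∈ exterior Ω) : Φ (exteriorInverse Φ z) = z :=
  hΦ.bijOn.invOn_invFunOn.2 hz

theorem IsExteriorMap.inverse_apply (hΦ : IsExteriorMap Ω Φ c μ) {ζ : ℂ} (hζ : 1 < ‖ζ‖) :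
    exteriorInverse Φ (Φ ζ) = ζ :=
  hΦ.bijOn.invOn_invFunOn.1 hζ

theorem IsExteriorMap.mem_exterior (hΦ : IsExteriorMap Ω Φ c μ) {ζ : ℂ} (hζ : 1 < ‖ζ‖) :
    Φ ζ ∈ exterior Ω :=
  hΦ.bijOn.mapsTo hζ

theorem IsExteriorMap.analyticAt_inverse (hΦ : IsExteriorMap Ω Φ c μ) {z : ℂ}
    (hz : z ∈ exterior Ω) : AnalyticAt ℂ (exteriorInverse Φ) z := by
  have h1 := hΦ.one_lt_norm_inverse hz
  have h := analyticAt_of_eventually_leftInverse (g := exteriorInverse Φ) (hΦ.analyticAt h1) (by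
    filter_upwards [isOpen_one_lt_norm.mem_nhds h1] with ζ hζ
    exact hΦ.inverse_apply hζ)
  rwa [hΦ.apply_inverse hz] at h

theorem laurentTail_zero (μ : ℕ → ℂ) : laurentTail μ 0 = μ 0 := by
  rw [laurentTail, tsum_eq_single 0 fun k hk => by simp [hk]]
  simp

theorem IsExteriorMap.apply_eq (hΦ : IsExteriorMap Ω Φ c μ) {ζ : ℂ} (hζ : 1 < ‖ζ‖) :
    Φ ζ = c * ζ + laurentTail μ ζ⁻¹ := by
  have h := (hΦ.expansion ζ hζ).tsum_eq
  simp only [div_eq_mul_inv, ← inv_pow] at h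
  rw [laurentTail, h]
  ring

theorem IsExteriorMap.hasFPowerSeriesAt_laurentTail (hΦ : IsExteriorMap Ω Φ c μ) :
    HasFPowerSeriesAt (laurentTail μ) (FormalMultilinearSeries.ofScalars ℂ μ) 0 := by
  refine hasFPowerSeriesAt_ofScalars ?_
  filter_upwards [Metric.ball_mem_nhds (0 : ℂ) one_pos] with w hw
  refine Summable.hasSum ?_
  by_cases hw0 : w = 0
  · refine summable_of_ne_finset_zero (s := {0}) fun k hk => ?_
    simp only [Finset.mem_singleton] at hk
    simp [hw0, hk]
  · have h1 : 1 < ‖w⁻¹‖ := by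
      rw [norm_inv]
      exact (one_lt_inv₀ (norm_pos_iff.2 hw0)).2 (mem_ball_zero_iff.1 hw)
    refine (hΦ.expansion w⁻¹ h1).summable.congr fun k => ?_
    rw [inv_pow, div_inv_eq_mul]

theorem IsExteriorMap.tendsto_cobounded (hΦ : IsExteriorMap Ω Φ c μ) :
    Tendsto Φ (cobounded ℂ) (cobounded ℂ) := by
  have hM : Tendsto (fun ζ : ℂ => laurentTail μ ζ⁻¹) (cobounded ℂ) (𝓝 (laurentTail μ 0)) :=
    hΦ.hasFPowerSeriesAt_laurentTail.analyticAt.continuousAt.tendsto.comp tendsto_inv₀_cobounded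
  rw [← tendsto_norm_atTop_iff_cobounded]
  have h1 : Tendsto (fun ζ : ℂ => c * ‖ζ‖ + -‖laurentTail μ ζ⁻¹‖) (cobounded ℂ) atTop :=
    (tendsto_norm_cobounded_atTop.const_mul_atTop hΦ.pos).atTop_add hM.norm.neg
  refine tendsto_atTop_mono' _ ?_ h1
  filter_upwards [eventually_cobounded_norm_gt 1] with ζ hζ
  rw [hΦ.apply_eq hζ]
  have h2 := norm_sub_le_norm_add ((c : ℂ) * ζ) (laurentTail μ ζ⁻¹)
  rw [norm_mul, Complex.norm_real, Real.norm_of_nonneg hΦ.pos.le] at h2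
  linarith

/-- Near infinity the inverse `Ψ` of the exterior map satisfies `1 / Ψ(z) = G(1/z)` with `G`
holomorphic at `0` and `G(t) = t (c + G(t) ∑ μₖ G(t)ᵏ)`: the function `G` is the local inverse of
`w ↦ 1 / Φ(1/w) = w / (c + w ∑ μₖ wᵏ)`. -/
theorem IsExteriorMap.exists_inverse_at_infinity (hΦ : IsExteriorMap Ω Φ c μ) :
    ∃ G : ℂ → ℂ, AnalyticAt ℂ G 0 ∧ G 0 = 0 ∧
      (∀ᶠ z in cobounded ℂ, (exteriorInverse Φ z)⁻¹ = G z⁻¹) ∧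
      ∀ᶠ t in 𝓝 (0 : ℂ), G t = t * (c + G t * laurentTail μ (G t)) := by
  have hc : (c : ℂ) ≠ 0 := Complex.ofReal_ne_zero.2 hΦ.pos.ne'
  have hM := hΦ.hasFPowerSeriesAt_laurentTail.analyticAt
  -- `Ψ(t⁻¹)⁻¹` at `t = 0` is a junk value (`0⁻¹ = 0`), so `G` is given the value `0` there.
  let F : ℂ → ℂ := fun w => w / (c + w * laurentTail μ w)
  let G : ℂ → ℂ := Function.update (fun t => (exteriorInverse Φ t⁻¹)⁻¹) 0 0
  have hden : AnalyticAt ℂ (fun w => c + w * laurentTail μ w) 0 :=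
    analyticAt_const.add (analyticAt_id.mul hM)
  have hden0 : ∀ᶠ w in 𝓝 (0 : ℂ), c + w * laurentTail μ w ≠ 0 :=
    hden.continuousAt.eventually_ne (by simpa using hc)
  have hF : AnalyticAt ℂ F 0 := analyticAt_id.div hden (by simpa using hc)
  have hF0 : F 0 = 0 := by simp [F]
  have hG0 : G 0 = 0 := by simp [G]
  have hGF : ∀ᶠ w in 𝓝 (0 : ℂ), G (F w) = w := by
    filter_upwards [hden0, Metric.ball_mem_nhds (0 : ℂ) one_pos] with w hw hw1
    by_cases hw0 : w = 0
    · rw [hw0, hF0, hG0]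
    · have h1 : 1 < ‖w⁻¹‖ := by
        rw [norm_inv]
        exact (one_lt_inv₀ (norm_pos_iff.2 hw0)).2 (mem_ball_zero_iff.1 hw1)
      have hFw : F w ≠ 0 := div_ne_zero hw0 hw
      have hFi : (F w)⁻¹ = Φ w⁻¹ := by
        rw [hΦ.apply_eq h1, inv_inv]
        simp only [F]
        field_simp
      simp only [G, Function.update_of_ne hFw, hFi, hΦ.inverse_apply h1, inv_inv]
  obtain ⟨hGc, hFG⟩ := continuousAt_of_eventually_leftInverse hF hGF
  have hGa := analyticAt_of_eventually_leftInverse hF hGF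
  rw [hF0] at hGc hFG hGa
  refine ⟨G, hGa, hG0, ?_, ?_⟩
  · filter_upwards [eventually_cobounded_norm_gt 0] with z hz
    have : z⁻¹ ≠ 0 := inv_ne_zero (norm_pos_iff.1 hz)
    simp only [G, Function.update_of_ne this, inv_inv]
  · have hden' : ∀ᶠ t in 𝓝 (0 : ℂ), c + G t * laurentTail μ (G t) ≠ 0 := by
      rw [ContinuousAt, hG0] at hGc
      exact hGc.eventually hden0
    filter_upwards [hFG, hden'] with t ht hd
    simp only [F] at ht
    rw [div_eq_iff hd] at ht
    exact ht

/-- The first two coefficients of `G(t) = t (c + G(t) ∑ μₖ G(t)ᵏ)` are `c` and `c μ₀`. -/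
theorem coeff_inverse_at_infinity {M G : ℂ → ℂ} {c : ℂ} {p : FormalMultilinearSeries ℂ ℂ ℂ}
    (hM : AnalyticAt ℂ M 0) (hG : HasFPowerSeriesAt G p 0) (hG0 : G 0 = 0)
    (hGM : ∀ᶠ t in 𝓝 (0 : ℂ), G t = t * (c + G t * M (G t))) :
    p.coeff 1 = c ∧ p.coeff 2 = c * M 0 := by
  have hMG : DifferentiableAt ℂ (fun t => M (G t)) 0 :=
    DifferentiableAt.comp (g := M) 0 (by rw [hG0]; exact hM.differentiableAt)
      hG.analyticAt.differentiableAt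
  have hGd : HasDerivAt G (p.coeff 1) 0 := hG.hasDerivAt
  have hK : HasDerivAt (fun t => c + G t * M (G t)) (p.coeff 1 * M 0) 0 := by
    have := (hGd.mul hMG.hasDerivAt).const_add c
    simpa [hG0] using this
  have h1 : p.coeff 1 = c := by
    have h2 : HasDerivAt G (1 * (c + G 0 * M (G 0)) + 0 * (p.coeff 1 * M 0)) 0 :=
      ((hasDerivAt_id (0 : ℂ)).mul hK).congr_of_eventuallyEq hGM
    have h3 := hGd.unique h2
    rwa [hG0, zero_mul, zero_mul, add_zero, add_zero, one_mul] at h3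
  have hslope : dslope G 0 =ᶠ[𝓝 0] fun t => c + G t * M (G t) := by
    filter_upwards [hGM] with t ht
    by_cases h : t = 0
    · rw [h, dslope_same, hGd.deriv, hG0, h1, zero_mul, add_zero]
    · rw [dslope_of_ne _ h, slope_def_field, hG0, sub_zero, sub_zero, div_eq_iff h, mul_comm]
      exact ht
  have h2 : HasDerivAt (dslope G 0) (p.fslope.coeff 1) 0 :=
    hG.has_fpower_series_dslope_fslope.hasDerivAt
  have h3 := h2.unique (hK.congr_of_eventuallyEq hslope)
  rw [FormalMultilinearSeries.coeff_fslope, h1] at h3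
  exact ⟨h1, h3⟩

end

/-! ### The solution for a linear background potential -/

/-- The complex potential `e (c ζ + μ₀) + conj e · c / ζ`, with `ζ = Φ⁻¹(z)`, whose real part solves
the problem for the background potential `Re (e z)`. -/
noncomputable def complexPotential (Φ : ℂ → ℂ) (c : ℝ) (μ : ℕ → ℂ) (e z : ℂ) : ℂ :=
  e * (c * exteriorInverse Φ z + μ 0) + conj e * c * (exteriorInverse Φ z)⁻¹

/-- The stream function vanishes on the unit circle of the `ζ`-plane. -/
theorem im_joukowski (e ζ m : ℂ) (c : ℝ) :
    (e * (c * ζ + m) + conj e * c * ζ⁻¹).im - (e * m).im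
      = c * (1 - (‖ζ‖ ^ 2)⁻¹) * (e * ζ).im := by
  rw [Complex.inv_def, Complex.normSq_eq_norm_sq]
  simp only [Complex.add_im, Complex.mul_im, Complex.mul_re, Complex.add_re, Complex.conj_re,
    Complex.conj_im, Complex.ofReal_re, Complex.ofReal_im]
  ring

theorem abs_det_smul_one (a : ℂ) : |(a • (1 : ℂ →L[ℝ] ℂ)).det| = ‖a‖ ^ 2 := by
  have h : (a • (1 : ℂ →L[ℝ] ℂ)).det = Algebra.norm ℝ a := by
    rw [Algebra.norm_apply]
    rfl
  rw [h, Algebra.norm_complex_apply, Complex.normSq_eq_norm_sq, abs_of_nonneg (by positivity)]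

section

variable {Ω : Set ℂ} {Φ : ℂ → ℂ} {c : ℝ} {μ : ℕ → ℂ}

theorem IsExteriorMap.analyticAt_complexPotential (hΦ : IsExteriorMap Ω Φ c μ) (e : ℂ) {z : ℂ}
    (hz : z ∈ exterior Ω) : AnalyticAt ℂ (complexPotential Φ c μ e) z := by
  have h0 : exteriorInverse Φ z ≠ 0 :=
    norm_pos_iff.1 (zero_lt_one.trans (hΦ.one_lt_norm_inverse hz))
  have h := hΦ.analyticAt_inverse hz
  exact (analyticAt_const.mul ((analyticAt_const.mul h).add analyticAt_const)).add
    (analyticAt_const.mul (h.inv h0))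

/-- Preimages of bounded sets under the exterior map are bounded. -/
theorem IsExteriorMap.exists_norm_le (hΦ : IsExteriorMap Ω Φ c μ) (R : ℝ) :
    ∃ R' > 0, ∀ ζ, ‖Φ ζ‖ ≤ R → ‖ζ‖ ≤ R' := by
  obtain ⟨R', hR', h⟩ := eventually_cobounded_iff.1
    (hΦ.tendsto_cobounded.eventually (eventually_cobounded_norm_gt R))
  refine ⟨R', hR', fun ζ hζ => ?_⟩
  by_contra hlt
  exact absurd (h ζ (not_le.1 hlt)) (not_lt.2 hζ)

theorem IsExteriorMap.sq_integrable_re_complexPotential (hΦ : IsExteriorMap Ω Φ c μ) (e : ℂ)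
    (R : ℝ) :
    IntegrableOn (fun z => (complexPotential Φ c μ e z).re ^ 2) (exterior Ω ∩ Metric.ball 0 R) := by
  have hD := isOpen_exterior Ω
  obtain ⟨R', hR', hb⟩ := hΦ.exists_norm_le R
  have hcont : ContinuousOn (fun z => (complexPotential Φ c μ e z).re ^ 2) (exterior Ω) :=
    (Complex.continuous_re.comp_continuousOn fun z hz =>
      (hΦ.analyticAt_complexPotential e hz).continuousAt.continuousWithinAt).pow 2
  have hm : MeasurableSet (exterior Ω ∩ Metric.ball (0 : ℂ) R) :=
    hD.measurableSet.inter measurableSet_ball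
  have hfin : volume (exterior Ω ∩ Metric.ball (0 : ℂ) R) < ⊤ :=
    (measure_mono Set.inter_subset_right).trans_lt measure_ball_lt_top
  refine (integrableOn_const (C := (‖e‖ * (c * R' + ‖μ 0‖) + ‖e‖ * c) ^ 2) hfin.ne).mono'
    ((hcont.mono Set.inter_subset_left).aestronglyMeasurable hm) ?_
  refine (ae_restrict_iff' hm).2 (Eventually.of_forall fun z hz => ?_)
  have h1 := hΦ.one_lt_norm_inverse hz.1
  have h2 : ‖exteriorInverse Φ z‖ ≤ R' := hb _ (by
    rw [hΦ.apply_inverse hz.1]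
    exact (mem_ball_zero_iff.1 hz.2).le)
  rw [norm_pow]
  refine pow_le_pow_left₀ (norm_nonneg _) ((Complex.abs_re_le_norm _).trans ?_) 2
  refine (norm_add_le _ _).trans (add_le_add ?_ ?_)
  · rw [norm_mul]
    gcongr
    refine (norm_add_le _ _).trans ?_
    rw [norm_mul, Complex.norm_real, Real.norm_of_nonneg hΦ.pos.le]
    have := hΦ.pos
    gcongr
  · rw [norm_mul, norm_mul, Complex.norm_conj, Complex.norm_real, Real.norm_of_nonneg hΦ.pos.le,
      norm_inv]
    have := hΦ.pos
    exact mul_le_of_le_one_right (by positivity) (inv_le_one_of_one_le₀ h1.le)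

/-- The Dirichlet integral is conformally invariant, and the derivative of
`e (c ζ + μ₀) + conj e · c / ζ` is bounded for `|ζ| > 1`. -/
theorem IsExteriorMap.gradient_sq_integrable_re_complexPotential (hΦ : IsExteriorMap Ω Φ c μ)
    (e : ℂ) (R : ℝ) :
    IntegrableOn (fun z => ‖gradient (fun z => (complexPotential Φ c μ e z).re) z‖ ^ 2)
      (exterior Ω ∩ Metric.ball 0 R) := by
  have hD := isOpen_exterior Ω
  obtain ⟨R', hR', hb⟩ := hΦ.exists_norm_le R
  have hm : MeasurableSet (exterior Ω ∩ Metric.ball (0 : ℂ) R) :=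
    hD.measurableSet.inter measurableSet_ball
  have hS : IsOpen ({ζ : ℂ | 1 < ‖ζ‖} ∩ Φ ⁻¹' Metric.ball 0 R) :=
    hΦ.holomorphic.continuousOn.isOpen_inter_preimage isOpen_one_lt_norm Metric.isOpen_ball
  have himage : Φ '' ({ζ : ℂ | 1 < ‖ζ‖} ∩ Φ ⁻¹' Metric.ball 0 R) =
      exterior Ω ∩ Metric.ball 0 R := by
    rw [Set.image_inter_preimage, hΦ.bijOn.image_eq]
  have hgrad : IntegrableOn (fun z => ‖deriv (complexPotential Φ c μ e) z‖ ^ 2)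
      (exterior Ω ∩ Metric.ball 0 R) := by
    rw [← himage, integrableOn_image_iff_integrableOn_abs_det_fderiv_smul volume hS.measurableSet
      (f' := fun ζ => deriv Φ ζ • (1 : ℂ →L[ℝ] ℂ))
      (fun ζ hζ => (hΦ.analyticAt
        hζ.1).differentiableAt.hasDerivAt.complexToReal_fderiv.hasFDerivWithinAt)
      (hΦ.bijOn.injOn.mono Set.inter_subset_left)]
    have hderiv : ∀ ζ, 1 < ‖ζ‖ → deriv (complexPotential Φ c μ e) (Φ ζ) * deriv Φ ζ =
        e * c - conj e * c * (ζ ^ 2)⁻¹ := by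
      intro ζ hζ
      have hζ0 : ζ ≠ 0 := norm_pos_iff.1 (zero_lt_one.trans hζ)
      have h1 : HasDerivAt (fun ζ => complexPotential Φ c μ e (Φ ζ))
          (deriv (complexPotential Φ c μ e) (Φ ζ) * deriv Φ ζ) ζ :=
        (hΦ.analyticAt_complexPotential e
          (hΦ.mem_exterior hζ)).differentiableAt.hasDerivAt.comp ζ
          (hΦ.analyticAt hζ).differentiableAt.hasDerivAt
      have h2 : HasDerivAt (fun ζ => e * (c * ζ + μ 0) + conj e * c * ζ⁻¹)
          (e * c - conj e * c * (ζ ^ 2)⁻¹) ζ := by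
        have := ((((hasDerivAt_id ζ).const_mul (c : ℂ)).add_const (μ 0)).const_mul e).add
          ((hasDerivAt_inv hζ0).const_mul (conj e * c))
        refine this.congr_deriv ?_
        ring
      refine h1.unique (h2.congr_of_eventuallyEq ?_)
      filter_upwards [isOpen_one_lt_norm.mem_nhds hζ] with ξ hξ
      rw [complexPotential, hΦ.inverse_apply hξ]
    have hfin : volume ({ζ : ℂ | 1 < ‖ζ‖} ∩ Φ ⁻¹' Metric.ball 0 R) < ⊤ := by
      refine (measure_mono ?_).trans_lt (measure_closedBall_lt_top (x := (0 : ℂ)) (r := R'))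
      exact fun ζ hζ => mem_closedBall_zero_iff.2 (hb ζ (mem_ball_zero_iff.1 hζ.2).le)
    have hbound : IntegrableOn (fun ζ : ℂ => ‖e * c - conj e * c * (ζ ^ 2)⁻¹‖ ^ 2)
        ({ζ : ℂ | 1 < ‖ζ‖} ∩ Φ ⁻¹' Metric.ball 0 R) := by
      refine (integrableOn_const (C := (‖e‖ * c + ‖e‖ * c) ^ 2) hfin.ne).mono' ?_ ?_
      · refine ContinuousOn.aestronglyMeasurable (fun ζ hζ => ?_) hS.measurableSet
        have hζ0 : ζ ^ 2 ≠ 0 := pow_ne_zero 2 (norm_pos_iff.1 (zero_lt_one.trans hζ.1))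
        exact ((continuousAt_const.sub (continuousAt_const.mul
          ((continuousAt_id.pow 2).inv₀ hζ0))).norm.pow 2).continuousWithinAt
      · refine (ae_restrict_iff' hS.measurableSet).2 (Eventually.of_forall fun ζ hζ => ?_)
        rw [norm_pow, norm_norm]
        refine pow_le_pow_left₀ (norm_nonneg _) ((norm_sub_le _ _).trans (add_le_add ?_ ?_)) 2
        · rw [norm_mul, Complex.norm_real, Real.norm_of_nonneg hΦ.pos.le]
        · rw [norm_mul, norm_mul, Complex.norm_conj, Complex.norm_real,
            Real.norm_of_nonneg hΦ.pos.le, norm_inv, norm_pow]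
          have := hΦ.pos
          exact mul_le_of_le_one_right (by positivity)
            (inv_le_one_of_one_le₀ (one_le_pow₀ (le_of_lt hζ.1)))
    refine hbound.congr_fun (fun ζ hζ => ?_) hS.measurableSet
    simp only [abs_det_smul_one, smul_eq_mul]
    rw [← hderiv ζ hζ.1, norm_mul]
    ring
  refine hgrad.congr_fun (fun z hz => ?_) hm
  simp only
  rw [gradient_re (hΦ.analyticAt_complexPotential e hz.1).differentiableAt, Complex.norm_conj]

theorem IsExteriorMap.stream_eq (hΦ : IsExteriorMap Ω Φ c μ) (e : ℂ) {ζ : ℂ} (hζ : 1 < ‖ζ‖) :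
    (complexPotential Φ c μ e (Φ ζ)).im - (e * μ 0).im
      = c * (1 - (‖ζ‖ ^ 2)⁻¹) * (e * ζ).im := by
  rw [complexPotential, hΦ.inverse_apply hζ, im_joukowski]

/-- The stream function vanishes only on the image of a line through the origin. -/
theorem IsExteriorMap.volume_stream_eq_zero (hΦ : IsExteriorMap Ω Φ c μ) {e : ℂ} (he : e ≠ 0) :
    volume {z ∈ exterior Ω | (complexPotential Φ c μ e z).im - (e * μ 0).im = 0} = 0 := by
  let L : Submodule ℝ ℂ := LinearMap.ker
    (Complex.imLm.comp (LinearMap.mulLeft ℝ e))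
  have hL : L ≠ ⊤ := by
    intro h
    have h1 : e⁻¹ * Complex.I ∈ L := by rw [h]; trivial
    have h2 : (e * (e⁻¹ * Complex.I)).im = 0 := h1
    rw [mul_inv_cancel_left₀ he, Complex.I_im] at h2
    exact one_ne_zero h2
  have h1 : volume (Φ '' ({ζ : ℂ | 1 < ‖ζ‖} ∩ L)) = 0 := by
    refine addHaar_image_eq_zero_of_differentiableOn_of_addHaar_eq_zero volume
      (fun ζ hζ => ?_) (measure_mono_null Set.inter_subset_right
        (Measure.addHaar_submodule volume L hL))
    exact ((hΦ.analyticAt hζ.1).differentiableAt.restrictScalars ℝ).differentiableWithinAt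
  refine measure_mono_null ?_ h1
  rintro z ⟨hz, hz0⟩
  have hζ := hΦ.one_lt_norm_inverse hz
  refine ⟨exteriorInverse Φ z, ⟨hζ, ?_⟩, hΦ.apply_inverse hz⟩
  rw [← hΦ.apply_inverse hz, hΦ.stream_eq e hζ] at hz0
  have h2 : (‖exteriorInverse Φ z‖ ^ 2)⁻¹ < 1 := inv_lt_one_of_one_lt₀ (one_lt_pow₀ hζ two_ne_zero)
  have h3 : c * (1 - (‖exteriorInverse Φ z‖ ^ 2)⁻¹) ≠ 0 :=
    mul_ne_zero hΦ.pos.ne' (sub_pos.2 h2).ne'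
  exact (mul_eq_zero.1 hz0).resolve_left h3

/-- The stream function tends to `0` at the boundary of `Ω`. -/
theorem IsExteriorMap.exists_isCompact_stream_lt (hΦ : IsExteriorMap Ω Φ c μ) (e : ℂ) {ε : ℝ}
    (hε : 0 < ε) (R : ℝ) : ∃ K ⊆ exterior Ω, IsCompact K ∧
      ∀ z ∈ exterior Ω, z ∉ K →
        |(complexPotential Φ c μ e z).im - (e * μ 0).im| < ε ∨ R < ‖z‖ := by
  obtain ⟨R', hR', hb⟩ := hΦ.exists_norm_le R
  -- The conditions defining `T` are closed, and they exclude the unit circle because `ε > 0`.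
  let T : Set ℂ := {ζ | ‖ζ‖ ≤ R' ∧ 1 ≤ ‖ζ‖ ∧ ε * ‖ζ‖ ^ 2 ≤ |c * (‖ζ‖ ^ 2 - 1) * (e * ζ).im|}
  have hT : ∀ ζ ∈ T, 1 < ‖ζ‖ := by
    rintro ζ ⟨-, h1, h2⟩
    refine lt_of_le_of_ne h1 fun h => ?_
    rw [← h] at h2
    norm_num at h2
    linarith
  have hTc : IsCompact T := by
    refine Metric.isCompact_of_isClosed_isBounded ?_ ?_
    · have h1 : IsClosed {ζ : ℂ | ε * ‖ζ‖ ^ 2 ≤ |c * (‖ζ‖ ^ 2 - 1) * (e * ζ).im|} :=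
        isClosed_le (by fun_prop) (by fun_prop)
      exact (isClosed_le continuous_norm continuous_const).inter
        ((isClosed_le continuous_const continuous_norm).inter h1)
    · refine Metric.isBounded_closedBall (x := (0 : ℂ)) (r := R') |>.subset fun ζ hζ => ?_
      exact mem_closedBall_zero_iff.2 hζ.1
  refine ⟨Φ '' T, ?_, hTc.image_of_continuousOn (hΦ.holomorphic.continuousOn.mono hT), ?_⟩
  · rintro _ ⟨ζ, hζ, rfl⟩
    exact hΦ.mem_exterior (hT ζ hζ)
  · intro z hz hzK
    by_contra! hcon
    have hζ := hΦ.one_lt_norm_inverse hz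
    refine hzK ⟨exteriorInverse Φ z, ⟨hb _ ?_, hζ.le, ?_⟩, hΦ.apply_inverse hz⟩
    · rw [hΦ.apply_inverse hz]
      exact hcon.2
    · have h1 := hcon.1
      rw [← hΦ.apply_inverse hz, hΦ.stream_eq e hζ] at h1
      have hpos : 0 < ‖exteriorInverse Φ z‖ ^ 2 := by positivity
      have h2 : c * (‖exteriorInverse Φ z‖ ^ 2 - 1) * (e * exteriorInverse Φ z).im
          = (c * (1 - (‖exteriorInverse Φ z‖ ^ 2)⁻¹) * (e * exteriorInverse Φ z).im)
            * ‖exteriorInverse Φ z‖ ^ 2 := by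
        field_simp
      rw [h2, abs_mul, abs_of_pos hpos]
      gcongr

/-- The perturbation `Re W - Re (e z)` of the background potential is, near infinity, the real part
of a holomorphic function of `1/z` that vanishes at infinity. -/
theorem IsExteriorMap.complexPotential_sub_eq (hΦ : IsExteriorMap Ω Φ c μ) (hbdd : IsBounded Ω)
    (e : ℂ) {G : ℂ → ℂ} (hG : ∀ᶠ z in cobounded ℂ, (exteriorInverse Φ z)⁻¹ = G z⁻¹) :
    ∀ᶠ z in cobounded ℂ, (complexPotential Φ c μ e z).re - (e * z).re =
      (conj e * c * G z⁻¹ - e * (laurentTail μ (G z⁻¹) - μ 0)).re := by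
  filter_upwards [hG, exterior_mem_cobounded hbdd] with z hz hzD
  rw [← Complex.sub_re]
  congr 1
  have h := hΦ.apply_eq (hΦ.one_lt_norm_inverse hzD)
  rw [hΦ.apply_inverse hzD, hz] at h
  rw [complexPotential, hz]
  linear_combination (-e) * h

theorem isBigO_inv_of_eventually_eq_re {H : ℂ → ℂ} (hH : AnalyticAt ℂ H 0) (h0 : H 0 = 0)
    {f : ℂ → ℝ} (hf : ∀ᶠ z in cobounded ℂ, f z = (H z⁻¹).re) :
    f =O[cobounded ℂ] fun z => ‖z‖⁻¹ := by
  have h1 : H =O[𝓝 0] fun w => w := by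
    simpa [h0] using hH.differentiableAt.isBigO_sub
  have h2 : (fun z => H z⁻¹) =O[cobounded ℂ] fun z : ℂ => z⁻¹ :=
    h1.comp_tendsto tendsto_inv₀_cobounded
  have h3 : f =O[cobounded ℂ] fun z => H z⁻¹ := by
    refine Asymptotics.IsBigO.of_bound 1 ?_
    filter_upwards [hf] with z hz
    rw [hz, one_mul]
    exact Complex.abs_re_le_norm _
  refine (h3.trans h2).trans (Asymptotics.IsBigO.of_bound 1 (Eventually.of_forall fun z => ?_))
  rw [norm_inv, norm_inv, norm_norm, one_mul]

theorem IsExteriorMap.isSolution_re_complexPotential (hΦ : IsExteriorMap Ω Φ c μ)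
    (hbdd : IsBounded Ω) {e : ℂ} (he : e ≠ 0) :
    IsSolution Ω (fun z => (e * z).re) (fun z => (complexPotential Φ c μ e z).re) where
  harmonic z hz := (hΦ.analyticAt_complexPotential e hz).harmonicAt_re
  sq_integrable := hΦ.sq_integrable_re_complexPotential e
  gradient_sq_integrable := hΦ.gradient_sq_integrable_re_complexPotential e
  neumann φ hφ := setIntegral_inner_gradient_re_eq_zero (isOpen_exterior Ω)
    (fun z hz => (hΦ.analyticAt_complexPotential e hz).differentiableAt.differentiableWithinAt)
    (e * μ 0).im (hΦ.gradient_sq_integrable_re_complexPotential e)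
    (fun _ hε R => hΦ.exists_isCompact_stream_lt e hε R) (hΦ.volume_stream_eq_zero he) hφ
  decay := by
    obtain ⟨G, hG, hG0, hGΨ, -⟩ := hΦ.exists_inverse_at_infinity
    refine isBigO_inv_of_eventually_eq_re
      (H := fun w => conj e * c * G w - e * (laurentTail μ (G w) - μ 0)) ?_ ?_
      (hΦ.complexPotential_sub_eq hbdd e hGΨ)
    · refine (analyticAt_const.mul hG).sub
        (analyticAt_const.mul (AnalyticAt.sub ?_ analyticAt_const))
      exact AnalyticAt.fun_comp (by rw [hG0]; exact hΦ.hasFPowerSeriesAt_laurentTail.analyticAt) hG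
    · simp [hG0, laurentTail_zero]

/-- The response to the background potential `Re (e z)`, in terms of the power series `p` of `G` and
`q` of `∑_{k ≥ 1} μₖ Gᵏ`, where `G(1/z) = 1/Φ⁻¹(z)`. -/
theorem IsExteriorMap.isResponse (hΦ : IsExteriorMap Ω Φ c μ) (hbdd : IsBounded Ω)
    {e : ℂ} (he : e ≠ 0) {β : Trig} (hβ : harmonicPoly β 1 = fun z => (e * z).re)
    {G : ℂ → ℂ} {p q : FormalMultilinearSeries ℂ ℂ ℂ} (hG0 : G 0 = 0)
    (hGΨ : ∀ᶠ z in cobounded ℂ, (exteriorInverse Φ z)⁻¹ = G z⁻¹)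
    (hp : HasFPowerSeriesAt G p 0)
    (hq : HasFPowerSeriesAt (fun w => laurentTail μ (G w) - μ 0) q 0) :
    IsResponse Ω β 1 (multipoleCoeff fun m => conj e * c * p.coeff m - e * q.coeff m) := by
  refine ⟨fun z => (complexPotential Φ c μ e z).re, ?_, ?_⟩
  · rw [hβ]
    exact hΦ.isSolution_re_complexPotential hbdd he
  · rw [hβ]
    have hs : HasFPowerSeriesAt (fun w => conj e * c * G w - e * (laurentTail μ (G w) - μ 0))
        ((conj e * c) • p - e • q) 0 := (hp.const_smul (c := conj e * c)).sub (hq.const_smul (c := e))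
    have h := hasMultipoleExpansion_re hs (by simp [hG0, laurentTail_zero])
      (hΦ.complexPotential_sub_eq hbdd e hGΨ)
    exact h

/-- `γ²ₘ₁` is the coefficient of order `m` of `-c / Φ⁻¹(z)` at infinity: the coefficients `μₖ`,
`k ≥ 1`, cancel between the responses to `Re z` and `Im z`. -/
theorem IsExteriorMap.gamma2_one_eq (hΦ : IsExteriorMap Ω Φ c μ) (hbdd : IsBounded Ω)
    {G : ℂ → ℂ} {p : FormalMultilinearSeries ℂ ℂ ℂ} (hG0 : G 0 = 0)
    (hGΨ : ∀ᶠ z in cobounded ℂ, (exteriorInverse Φ z)⁻¹ = G z⁻¹)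
    (hp : HasFPowerSeriesAt G p 0) (m : ℕ+) : gamma2 Ω m 1 = -(c * p.coeff m) := by
  have hN : AnalyticAt ℂ (fun w => laurentTail μ (G w) - μ 0) 0 :=
    (AnalyticAt.fun_comp (by rw [hG0]; exact hΦ.hasFPowerSeriesAt_laurentTail.analyticAt)
      hp.analyticAt).sub analyticAt_const
  obtain ⟨q, hq⟩ := hN
  have hc : IsResponse Ω .c 1 _ := hΦ.isResponse hbdd one_ne_zero
    (by funext z; simp [harmonicPoly]) hG0 hGΨ hp hq
  have hs : IsResponse Ω .s 1 _ := hΦ.isResponse hbdd (neg_ne_zero.2 Complex.I_ne_zero)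
    (by funext z; simp [harmonicPoly]) hG0 hGΨ hp hq
  have hconn := hΦ.isPreconnected_exterior
  have hpi : (Real.pi : ℂ) ≠ 0 := Complex.ofReal_ne_zero.2 Real.pi_ne_zero
  have hm : ((m : ℕ) : ℂ) ≠ 0 := Nat.cast_ne_zero.2 m.ne_zero
  rw [gamma2, contractedGPT_eq hbdd hconn hc, contractedGPT_eq hbdd hconn hc,
    contractedGPT_eq hbdd hconn hs, contractedGPT_eq hbdd hconn hs]
  simp only [multipoleCoeff]
  push_cast
  rw [div_mul_eq_mul_div, one_mul, div_eq_iff (mul_ne_zero (mul_ne_zero (by norm_num) hpi) hm)]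
  apply Complex.ext
  · simp
    ring
  · simp
    ring

end

end InsulatedInclusion

theorem mainTheorem1 (Ω : Set ℂ) (hopen : IsOpen Ω) (hbdd : Bornology.IsBounded Ω)
    (hsc : IsSimplyConnected Ω)
    (Φ : ℂ → ℂ) (c : ℝ) (μ : ℕ → ℂ) (hΦ : InsulatedInclusion.IsExteriorMap Ω Φ c μ) :
    (c : ℂ) ^ 2 = -InsulatedInclusion.gamma2 Ω 1 1 ∧
      μ 0 = -((c : ℂ) ^ 2)⁻¹ * InsulatedInclusion.gamma2 Ω 2 1 := by
  obtain ⟨G, ⟨p, hp⟩, hG0, hGΨ, hGM⟩ := hΦ.exists_inverse_at_infinity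
  obtain ⟨h1, h2⟩ := InsulatedInclusion.coeff_inverse_at_infinity
    hΦ.hasFPowerSeriesAt_laurentTail.analyticAt hp hG0 hGM
  have hc : (c : ℂ) ≠ 0 := Complex.ofReal_ne_zero.2 hΦ.pos.ne'
  rw [InsulatedInclusion.laurentTail_zero] at h2
  rw [hΦ.gamma2_one_eq hbdd hG0 hGΨ hp, hΦ.gamma2_one_eq hbdd hG0 hGΨ hp]
  change _ = - -((c : ℂ) * p.coeff 1) ∧ _ = _ * -((c : ℂ) * p.coeff 2)
  rw [h1, h2]
  constructor
  · ring
  · field_simp
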